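/- Let $0<\alpha,\beta<1$ and $T>0$. Write $(\cdot,\cdot)$ and $\|\cdot\|$ for the inner product and norm of $L^2(\mathbb{R})$, and let $$I\phi(t)=\frac{\alpha/\beta}{\Gamma(\beta)}\,t^{-\alpha}\int_0^t\tau^{\alpha/\beta-1}\bigl(t^{\alpha/\beta}-\tau^{\alpha/\beta}\bigr)^{\beta-1}\phi(\tau)\,d\tau,\qquad D_{EK}\phi(t)=\Bigl(\beta+\frac{\beta}{\alpha}\,t\frac{d}{dt}\Bigr)I\phi(t)$$ be the Erdélyi–Kober operators $I=I^{0,\beta}_{\alpha/\beta}$ and $D_{EK}=D^{\beta-1,1-\beta}_{\alpha/\beta}$. For a time step $k>0$ put $t_n=nk$ and $$c_{n,i}=\frac{1}{\beta\Gamma(\beta)}\Bigl[\Bigl(1-\bigl(\tfrac{i-1}{n}\bigr)^{\alpha/\beta}\Bigr)^{\beta}-\Bigl(1-\bigl(\tfrac{i}{n}\bigr)^{\alpha/\beta}\Bigr)^{\beta}\Bigr],\qquad L\phi^n=\sum_{i=1}^n c_{n,i}\phi^i\quad(L\phi^0=0),$$ $$G\phi^n=\beta L\phi^n+\frac{\beta}{\alpha}\,t_n\,\frac{L\phi^n-L\phi^{n-1}}{k}\qquad(n\ge1).$$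 Let $u_0\in H^2(\mathbb{R})$ and let $u\in C([0,T];L^2(\mathbb{R}))$, $u(0)=u_0$, be a solution (with $u(t)\in H^1(\mathbb{R})$ for $0<t\le T$) of the weak Erdélyi–Kober diffusion equation $$(u_t,\chi)=-\frac{\alpha}{\beta}\,t^{\alpha-1}\,(D_{EK}u_x,\chi_x)\qquad\text{for all }\chi\in H^1(\mathbb{R})\text{ and a.e. }t\in(0,T),$$ where subscripts $x$ and $t$ denote weak derivatives (those in time of $L^2(\mathbb{R})$-valued functions on $(0,T)$). Assume that for some constant $C$ and a.e. $t\in(0,T)$ $$\|u\|+t^{1-\alpha}\|u_t\|+t^{2-\alpha}\|u_{tt}\|\le C,\qquad \|u_x\|+t^{1-\alpha}\|u_{tx}\|+t^{2-\alpha}\|u_{ttx}\|\le C.$$ Then for every $\mu>0$ (arbitrarily small) there is a constant $D>0$, independent of $k$ and $n$, such that the following holds for every $k>0$. If $U^0=u_0$ and $U^n\in H^1(\mathbb{R})$ ($n\ge1$, $t_n\le T$) solve the semi-discrete problem $$\Bigl(\frac{U^n-U^{n-1}}{k},\chi\Bigr)=-\frac{\alpha}{\beta}\,t_n^{\alpha-1}\,(G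 U^n_x,\chi_x)\qquad\text{for all }\chi\in H^1(\mathbb{R}),$$ then for all $n\ge 0$ with $t_n\le T$ $$\|U^n-u(t_n)\|\le D\,k^{\alpha-\mu/2}\quad\text{if }\alpha\neq\beta,$$ $$\|U^n-u(t_n)\|\le D\,k^{\alpha}\bigl((-\log k)^{1/2}+k^{\mu/2}\bigr)\quad\text{if }\alpha=\beta\text{ and }k<1.$$ -/

import Mathlib

open MeasureTheory Set
open scoped ContDiff

noncomputable section

namespace ErdelyiKober

/-- The real Hilbert space `L²(ℝ)`. -/
abbrev L2 : Type := Lp ℝ 2 (volume : Measure ℝ)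

/-- `w` is the weak derivative of `v` on the open set `s ⊆ ℝ`: both are locally integrable on `s`
and `∫ φ' v = -∫ φ w` for every smooth `φ` with compact support in `s`.  It is used with
`s = ℝ`, `E = ℝ` for the space variable and with `s = (0, T)`, `E = L²(ℝ)` for the time variable. -/
def HasWeakDerivOn {E : Type*} [NormedAddCommGroup E] [NormedSpace ℝ E]
    (v w : ℝ → E) (s : Set ℝ) : Prop :=
  LocallyIntegrableOn v s ∧ LocallyIntegrableOn w s ∧
    ∀ φ : ℝ → ℝ, ContDiff ℝ ∞ φ → HasCompactSupport φ → tsupport φ ⊆ s →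
      ∫ t, deriv φ t • v t = -∫ t, φ t • w t

/-- `f ∈ H¹(ℝ)` with weak derivative `g ∈ L²(ℝ)`. -/
def HasSpaceDeriv (f g : L2) : Prop :=
  HasWeakDerivOn (f : ℝ → ℝ) (g : ℝ → ℝ) univ

/-- `f ∈ H²(ℝ)`. -/
def MemH2 (f : L2) : Prop :=
  ∃ g h : L2, HasSpaceDeriv f g ∧ HasSpaceDeriv g h

/-- The Erdélyi–Kober fractional integral
`I_η^{γ,μ} φ (t) = η / Γ(μ) t^{-η(μ+γ)} ∫₀ᵗ τ^{η(γ+1)-1} (t^η - τ^η)^{μ-1} φ(τ) dτ`,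
for functions of time with values in a normed space. -/
def ekIntegral {E : Type*} [NormedAddCommGroup E] [NormedSpace ℝ E]
    (η γ μ : ℝ) (φ : ℝ → E) (t : ℝ) : E :=
  (η / Real.Gamma μ * t ^ (-(η * (μ + γ)))) •
    ∫ τ in (0 : ℝ)..t, (τ ^ (η * (γ + 1) - 1) * (t ^ η - τ ^ η) ^ (μ - 1)) • φ τ

/-- The Erdélyi–Kober fractional derivative of order `0 < μ < 1`,
`D_η^{γ,μ} φ (t) = (γ + 1 + (1/η) t d/dt) I_η^{γ+μ,1-μ} φ (t)`. -/
def ekDeriv {E : Type*} [NormedAddCommGroup E] [NormedSpace ℝ E]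
    (η γ μ : ℝ) (φ : ℝ → E) (t : ℝ) : E :=
  (γ + 1) • ekIntegral η (γ + μ) (1 - μ) φ t +
    (1 / η * t) • deriv (fun r => ekIntegral η (γ + μ) (1 - μ) φ r) t

/-- The weights `c_{n,i}` of the rectangle rule. -/
def ekCoeff (α β : ℝ) (n i : ℕ) : ℝ :=
  1 / (β * Real.Gamma β) *
    ((1 - (((i : ℝ) - 1) / n) ^ (α / β)) ^ β - (1 - ((i : ℝ) / n) ^ (α / β)) ^ β)

/-- The discretization `L φ(t_n) = ∑_{i=1}^n c_{n,i} φ(t_i)` of `I_{α/β}^{0,β} φ(t_n)`, as a function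
of the grid values `φ i = φ(t_i)`. For `n = 0` the sum is empty. -/
def discreteEkIntegral {E : Type*} [NormedAddCommGroup E] [NormedSpace ℝ E]
    (α β : ℝ) (φ : ℕ → E) (n : ℕ) : E :=
  ∑ i ∈ Finset.Icc 1 n, ekCoeff α β n i • φ i

/-- The discretization `G φ(t_n) = β L φ(t_n) + (β/α) t_n (L φ(t_n) - L φ(t_{n-1})) / k` of
`D_{α/β}^{β-1,1-β} φ(t_n)`, where `t_n = n k` and `n ≥ 1`. -/
def discreteEkDeriv {E : Type*} [NormedAddCommGroup E] [NormedSpace ℝ E]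
    (α β k : ℝ) (φ : ℕ → E) (n : ℕ) : E :=
  β • discreteEkIntegral α β φ n +
    (β / α * (n * k) * (1 / k)) •
      (discreteEkIntegral α β φ n - discreteEkIntegral α β φ (n - 1))

/-- `u` (with weak derivatives `ut` in time and `ux` in space) solves on `[0, T]`, with initial value
`u0`, the weak form `(u_t, χ) = -(α/β) t^{α-1} (D_{α/β}^{β-1,1-β} u_x, χ_x)` for all `χ ∈ H¹(ℝ)`
of the Erdélyi–Kober diffusion equation. -/
structure IsWeakSolution (α β T : ℝ) (u0 : L2) (u ut ux : ℝ → L2) : Prop where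
  continuousOn : ContinuousOn u (Icc 0 T)
  initial : u 0 = u0
  time_deriv : HasWeakDerivOn u ut (Ioo 0 T)
  space_deriv : ∀ t ∈ Ioc 0 T, HasSpaceDeriv (u t) (ux t)
  equation : ∀ᵐ t ∂(volume.restrict (Ioo 0 T)),
    DifferentiableAt ℝ (fun r => ekIntegral (α / β) 0 β ux r) t ∧
    ∀ χ χx : L2, HasSpaceDeriv χ χx →
      inner ℝ (ut t) χ =
        -(α / β * t ^ (α - 1) * inner ℝ (ekDeriv (α / β) (β - 1) (1 - β) ux t) χx)

/-- `U n` (with weak derivative `Ux n` for `n ≥ 1`) solves the semi-discrete problem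
`((Uⁿ - Uⁿ⁻¹)/k, χ) = -(α/β) t_n^{α-1} (G Uⁿ_x, χ_x)` for all `χ ∈ H¹(ℝ)` and all `n ≥ 1` with
`t_n = n k ≤ T`, with `U⁰ = u0`. -/
structure IsSemiDiscreteSolution (α β T k : ℝ) (u0 : L2) (U Ux : ℕ → L2) : Prop where
  initial : U 0 = u0
  space_deriv : ∀ n : ℕ, 1 ≤ n → (n : ℝ) * k ≤ T → HasSpaceDeriv (U n) (Ux n)
  equation : ∀ n : ℕ, 1 ≤ n → (n : ℝ) * k ≤ T → ∀ χ χx : L2, HasSpaceDeriv χ χx →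
    inner ℝ ((1 / k) • (U n - U (n - 1))) χ =
      -(α / β * ((n : ℝ) * k) ^ (α - 1) * inner ℝ (discreteEkDeriv α β k Ux n) χx)

end ErdelyiKober

end

/-! The factor `t^(α-1)` turns the right-hand side of the equation into a time derivative: if J(t) =
t^α I u_x(t), then J' = (α/β) t^(α-1) D_EK u_x. Hence (u(t), χ) = (u_0, χ) - (J(t), χ_x)
(`IsWeakSolution.integrated_equation`), and the scheme takes the parallel form (U^(m+1) - U^m, χ) =
-k^α (B U_x, χ_x) with B = `discreteOp` (`IsSemiDiscreteSolution.step`). The kernel of J is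
homogeneous of degree α-1, so everything can be rescaled to the unit grid, where k enters only
through powers k^α.

Two facts carry the estimate. Coercivity (`sum_inner_discreteOp_ge`): the sum of (B y_m, y_m)
controls the sum of (m+1)^(α-1) ‖y_m‖². Consistency (`norm_kernelIntegral_sub_sub_discreteOp_le`):
J(m+1) - J(m) - B f has size A (m+1)^(α-1), where A is of order k^α for f(s) = u_x(ks), up to the
multiple `constDefect` of f(0). The weight (m+1)^(α-1) is the same in both, so Young's inequality
absorbs the consistency error into the coercive term at a cost that sums to order k^(2α). The defect
gains no power of k from regularity, but it is absolutely summable; since u_0 lies in H², the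
derivative on χ can be moved onto u_0x, so that the defect is paired with the error itself and not
with its space derivative.

Consistency compares quadrature errors at consecutive times. For α ≤ β the same cell is compared at
both times, and the kernel decreases in t. For α ≥ β cell j is compared with cell j+1 one step
later, where the kernel increases along the diagonal; this costs second differences of u_x, which
the bound on u_ttx controls.

Testing with the error and summing up to the index where it is largest gives order k^α. Both stated
rates are weaker: k ≤ T once n ≥ 1, and for α = β the bracket is bounded below by a positive
constant. -/

namespace ErdelyiKober

/-! ### Weak derivatives on an interval and primitives. -/

section WeakDerivatives

variable {E : Type*} [NormedAddCommGroup E] [NormedSpace ℝ E]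

open Filter Topology

/-- A test function of mean zero is the derivative of a test function. -/
theorem exists_testFunction_deriv_eq {s : Set ℝ} (hs : s.OrdConnected) {ζ : ℝ → ℝ}
    (hζ : ContDiff ℝ ∞ ζ) (hc : HasCompactSupport ζ) (hsupp : tsupport ζ ⊆ s)
    (hint : ∫ x, ζ x = 0) :
    ∃ Φ : ℝ → ℝ, ContDiff ℝ ∞ Φ ∧ HasCompactSupport Φ ∧ tsupport Φ ⊆ s ∧ deriv Φ = ζ := by
  rcases (tsupport ζ).eq_empty_or_nonempty with he | hne
  · have h0 : ζ = 0 := tsupport_eq_empty_iff.1 he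
    refine ⟨0, contDiff_const, HasCompactSupport.zero, ?_, ?_⟩
    · rw [tsupport_eq_empty_iff.2 rfl]; exact empty_subset _
    · rw [h0]; exact deriv_zero
  have hK : IsCompact (tsupport ζ) := hc
  set m := sInf (tsupport ζ) with hm
  set M := sSup (tsupport ζ) with hM
  have hmem : m ∈ tsupport ζ := hK.sInf_mem hne
  have hMem : M ∈ tsupport ζ := hK.sSup_mem hne
  have hlow : ∀ x, x < m → ζ x = 0 := fun x hx =>
    image_eq_zero_of_notMem_tsupport fun h => (csInf_le hK.bddBelow h).not_gt hx
  have hup : ∀ x, M < x → ζ x = 0 := fun x hx =>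
    image_eq_zero_of_notMem_tsupport fun h => (le_csSup hK.bddAbove h).not_gt hx
  have hmM : m ≤ M := csInf_le hK.bddBelow hMem
  have hd : ∀ x, HasDerivAt (fun y => ∫ t in m..y, ζ t) (ζ x) x := fun x =>
    intervalIntegral.integral_hasDerivAt_right (hζ.continuous.intervalIntegrable _ _)
      (hζ.continuous.stronglyMeasurableAtFilter _ _) hζ.continuous.continuousAt
  have hder : deriv (fun y => ∫ t in m..y, ζ t) = ζ := funext fun x => (hd x).deriv
  have hzero : ∀ x, x ∉ Icc m M → (∫ t in m..x, ζ t) = 0 := by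
    intro x hx
    rcases lt_or_ge x m with h | h
    · rw [intervalIntegral.integral_symm, intervalIntegral.integral_of_le h.le,
        integral_Ioc_eq_integral_Ioo, setIntegral_eq_zero_of_forall_eq_zero, neg_zero]
      exact fun t ht => hlow t ht.2
    · have hMx : M < x := by
        by_contra hh
        exact hx ⟨h, not_lt.1 hh⟩
      rw [intervalIntegral.integral_of_le h, ← integral_Icc_eq_integral_Ioc,
        setIntegral_eq_integral_of_forall_compl_eq_zero, hint]
      intro t ht
      by_cases h1 : t < m
      · exact hlow t h1
      · refine hup t (hMx.trans ?_)
        by_contra hh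
        exact ht ⟨not_lt.1 h1, not_lt.1 hh⟩
  have hsub : tsupport (fun y => ∫ t in m..y, ζ t) ⊆ Icc m M := by
    refine closure_minimal ?_ isClosed_Icc
    intro x hx
    by_contra h
    exact hx (hzero x h)
  refine ⟨fun y => ∫ t in m..y, ζ t, ?_, ?_, ?_, hder⟩
  · rw [contDiff_infty_iff_deriv]
    exact ⟨fun x => (hd x).differentiableAt, by rw [hder]; exact hζ⟩
  · exact HasCompactSupport.of_support_subset_isCompact isCompact_Icc
      ((subset_tsupport _).trans hsub)
  · exact hsub.trans (hs.out (hsupp hmem) (hsupp hMem))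

theorem LocallyIntegrableOn.integrable_smul_of_tsupport_subset {s : Set ℝ} {v : ℝ → E}
    (hv : LocallyIntegrableOn v s) {φ : ℝ → ℝ} (hφ : Continuous φ) (hc : HasCompactSupport φ)
    (hs : tsupport φ ⊆ s) : Integrable (fun t => φ t • v t) := by
  have h1 : IntegrableOn v (tsupport φ) := hv.integrableOn_compact_subset hs hc
  have h2 : IntegrableOn (fun t => φ t • v t) (tsupport φ) :=
    h1.continuousOn_smul hφ.continuousOn hc
  refine (integrableOn_iff_integrable_of_support_subset ?_).1 h2
  intro t ht
  by_contra h
  exact ht (by simp [image_eq_zero_of_notMem_tsupport h])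

theorem tsupport_deriv_subset_of_subset {s : Set ℝ} {φ : ℝ → ℝ} (h : tsupport φ ⊆ s) :
    tsupport (deriv φ) ⊆ s :=
  (closure_minimal (support_deriv_subset) (isClosed_tsupport φ)).trans h

/-- A locally integrable function with vanishing weak derivative is a.e. constant. -/
theorem exists_ae_eq_const_of_integral_deriv_smul_eq_zero [CompleteSpace E] {s : Set ℝ}
    (ho : IsOpen s) (hs : s.OrdConnected) {z : ℝ → E} (hz : LocallyIntegrableOn z s)
    (h : ∀ φ : ℝ → ℝ, ContDiff ℝ ∞ φ → HasCompactSupport φ → tsupport φ ⊆ s →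
      ∫ t, deriv φ t • z t = 0) :
    ∃ c : E, ∀ᵐ t, t ∈ s → z t = c := by
  rcases s.eq_empty_or_nonempty with he | ⟨x0, hx0⟩
  · exact ⟨0, by simp [he]⟩
  -- A fixed bump of integral 1: subtracting (∫g) times it from a test function `g` leaves mean
  -- zero, hence a derivative of a test function. The constant is then forced to be ∫ φ0 z.
  obtain ⟨ε, hε, hball⟩ := Metric.isOpen_iff.1 ho x0 hx0
  let b : ContDiffBump x0 := ⟨ε / 4, ε / 2, by positivity, by linarith⟩
  let φ0 : ℝ → ℝ := b.normed volume
  have hφ0 : ContDiff ℝ ∞ φ0 := b.contDiff_normed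
  have hφ0c : HasCompactSupport φ0 := b.hasCompactSupport_normed
  have hφ0s : tsupport φ0 ⊆ s := by
    rw [b.tsupport_normed_eq]
    refine (Metric.closedBall_subset_ball ?_).trans hball
    change ε / 2 < ε
    linarith
  have hφ0i : ∫ x, φ0 x = 1 := b.integral_normed
  set c : E := ∫ t, φ0 t • z t with hcdef
  refine ⟨c, ?_⟩
  have hzc : LocallyIntegrableOn (fun t => z t - c) s :=
    hz.sub ((locallyIntegrable_const c).locallyIntegrableOn s)
  have key : ∀ g : ℝ → ℝ, ContDiff ℝ ∞ g → HasCompactSupport g → tsupport g ⊆ s →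
      ∫ t, g t • (z t - c) = 0 := by
    intro g hg hgc hgs
    have hgi : Integrable g := hg.continuous.integrable_of_hasCompactSupport hgc
    have hφi : Integrable φ0 := hφ0.continuous.integrable_of_hasCompactSupport hφ0c
    set a := ∫ x, g x with ha
    have hsub : tsupport (fun x => g x - a * φ0 x) ⊆ tsupport g ∪ tsupport φ0 := by
      refine closure_minimal ?_ ((isClosed_tsupport _).union (isClosed_tsupport _))
      intro x hx
      by_contra hh
      rw [mem_union, not_or] at hh
      exact hx (by simp [image_eq_zero_of_notMem_tsupport hh.1,
        image_eq_zero_of_notMem_tsupport hh.2])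
    obtain ⟨Φ, h1, h2, h3, h4⟩ := exists_testFunction_deriv_eq (s := s) hs
      (ζ := fun x => g x - a * φ0 x) (hg.sub (contDiff_const.mul hφ0))
      (HasCompactSupport.of_support_subset_isCompact (hgc.isCompact.union hφ0c.isCompact)
        ((subset_tsupport _).trans hsub))
      (hsub.trans (union_subset hgs hφ0s))
      (by rw [integral_sub hgi (hφi.const_mul a), integral_const_mul, hφ0i]; simp [ha])
    have h5 := h Φ h1 h2 h3
    rw [h4] at h5
    have i1 := LocallyIntegrableOn.integrable_smul_of_tsupport_subset hz hg.continuous hgc hgs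
    have i2 := LocallyIntegrableOn.integrable_smul_of_tsupport_subset hz hφ0.continuous hφ0c hφ0s
    have e1 : ∫ t, (g t - a * φ0 t) • z t = (∫ t, g t • z t) - a • c := by
      simp_rw [sub_smul, mul_smul]
      rw [integral_sub i1 (by exact i2.smul a), integral_smul]
    simp_rw [smul_sub]
    rw [integral_sub i1 (hgi.smul_const c), integral_smul_const, ← e1, h5]
  filter_upwards [ho.ae_eq_zero_of_integral_contDiff_smul_eq_zero hzc key] with t ht hts
  exact sub_eq_zero.1 (ht hts)

theorem LocallyIntegrableOn.intervalIntegrable {F : Type*} [NormedAddCommGroup F] {s : Set ℝ}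
    (hs : s.OrdConnected) {w : ℝ → F}
    (hw : LocallyIntegrableOn w s) {a b : ℝ} (ha : a ∈ s) (hb : b ∈ s) :
    IntervalIntegrable w volume a b :=
  (intervalIntegrable_iff.2 ((hw.integrableOn_compact_subset (hs.uIcc_subset ha hb)
    isCompact_uIcc).mono_set uIoc_subset_uIcc))

theorem continuousOn_integral_of_locallyIntegrableOn {s : Set ℝ} (ho : IsOpen s)
    (hs : s.OrdConnected) {w : ℝ → E} (hw : LocallyIntegrableOn w s) {c : ℝ} (hc : c ∈ s) :
    ContinuousOn (fun t => ∫ r in c..t, w r) s := by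
  intro x hx
  refine ContinuousAt.continuousWithinAt ?_
  obtain ⟨ε, hε, hball⟩ := Metric.isOpen_iff.1 ho x hx
  have hl : x - ε / 2 ∈ s := hball (by rw [Metric.mem_ball, Real.dist_eq]; rw [abs_lt]; constructor <;> linarith)
  have hr : x + ε / 2 ∈ s := hball (by rw [Metric.mem_ball, Real.dist_eq]; rw [abs_lt]; constructor <;> linarith)
  have hi := hs.out (show min c (x - ε / 2) ∈ s by rcases min_choice c (x - ε / 2) with h | h <;> rw [h] <;> assumption)
    (show max c (x + ε / 2) ∈ s by rcases max_choice c (x + ε / 2) with h | h <;> rw [h] <;> assumption)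
  have hcont : ContinuousOn (fun t => ∫ r in c..t, w r)
      (uIcc (min c (x - ε / 2)) (max c (x + ε / 2))) := by
    have hle : min c (x - ε / 2) ≤ max c (x + ε / 2) := (min_le_left _ _).trans (le_max_left _ _)
    refine intervalIntegral.continuousOn_primitive_interval' ?_ ?_
    · rw [intervalIntegrable_iff, uIoc_of_le hle]
      exact (hw.integrableOn_compact_subset hi isCompact_Icc).mono_set Ioc_subset_Icc_self
    · rw [uIcc_of_le hle]
      exact ⟨min_le_left _ _, le_max_left _ _⟩
  refine hcont.continuousAt ?_
  rw [uIcc_of_le ((min_le_left _ _).trans (le_max_left _ _))]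
  refine Icc_mem_nhds ?_ ?_
  · exact (min_le_right _ _).trans_lt (by linarith)
  · exact lt_of_lt_of_le (by linarith) (le_max_right _ _)

/-- The primitive is absolutely continuous, so integration by parts holds on an interval around the
support, where the boundary terms vanish. Moving the base point from `c` to the left end adds a
constant, which is invisible because φ' has integral zero. -/
theorem integral_deriv_mul_primitive {s : Set ℝ} (ho : IsOpen s) (hs : s.OrdConnected)
    {w : ℝ → ℝ} (hw : LocallyIntegrableOn w s) {c : ℝ} (hc : c ∈ s) {φ : ℝ → ℝ}
    (hφ : ContDiff ℝ ∞ φ) (hφc : HasCompactSupport φ) (hφs : tsupport φ ⊆ s) :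
    ∫ t, deriv φ t * ∫ r in c..t, w r = -∫ t, φ t * w t := by
  rcases (tsupport φ).eq_empty_or_nonempty with he | hne
  · have h0 : φ = 0 := tsupport_eq_empty_iff.1 he
    simp [h0]
  have hK : IsCompact (tsupport φ) := hφc
  obtain ⟨m, hm, hm'⟩ : ∃ m ∈ s, ∀ x ∈ tsupport φ, m < x := by
    obtain ⟨ε, hε, hball⟩ := Metric.isOpen_iff.1 ho _ (hφs (hK.sInf_mem hne))
    refine ⟨sInf (tsupport φ) - ε / 2, hball ?_, fun x hx => ?_⟩
    · rw [Metric.mem_ball, Real.dist_eq, abs_lt]; constructor <;> linarith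
    · linarith [csInf_le hK.bddBelow hx]
  obtain ⟨M, hM, hM'⟩ : ∃ M ∈ s, ∀ x ∈ tsupport φ, x < M := by
    obtain ⟨ε, hε, hball⟩ := Metric.isOpen_iff.1 ho _ (hφs (hK.sSup_mem hne))
    refine ⟨sSup (tsupport φ) + ε / 2, hball ?_, fun x hx => ?_⟩
    · rw [Metric.mem_ball, Real.dist_eq, abs_lt]; constructor <;> linarith
    · linarith [le_csSup hK.bddAbove hx]
  have hmM : m ≤ M := by
    obtain ⟨x, hx⟩ := hne
    exact ((hm' x hx).trans (hM' x hx)).le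
  have hsupp : tsupport φ ⊆ Ioc m M := fun x hx => ⟨hm' x hx, (hM' x hx).le⟩
  have hfull : ∀ g : ℝ → ℝ, Function.support g ⊆ tsupport φ → ∫ t, g t = ∫ t in m..M, g t := by
    intro g hg
    exact (intervalIntegral.integral_eq_integral_of_support_subset (hg.trans hsupp)).symm
  have hwi : IntervalIntegrable w volume m M :=
    LocallyIntegrableOn.intervalIntegrable hs hw hm hM
  have acφ : AbsolutelyContinuousOnInterval φ m M :=
    (hφ.of_le (by norm_cast)).contDiffOn.absolutelyContinuousOnInterval
  have acW : AbsolutelyContinuousOnInterval (fun t => ∫ r in m..t, w r) m M :=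
    hwi.absolutelyContinuousOnInterval_intervalIntegral left_mem_uIcc
  have z1 : φ m = 0 := image_eq_zero_of_notMem_tsupport fun h => (hm' m h).ne rfl
  have z2 : φ M = 0 := image_eq_zero_of_notMem_tsupport fun h => (hM' M h).ne rfl
  have hIBP := acφ.integral_mul_deriv_eq_deriv_mul acW
  rw [z1, z2, zero_mul, zero_mul, sub_zero, zero_sub] at hIBP
  have e1 : ∫ t in m..M, φ t * deriv (fun t => ∫ r in m..t, w r) t = ∫ t in m..M, φ t * w t := by
    refine intervalIntegral.integral_congr_ae ?_
    filter_upwards [hwi.ae_hasDerivAt_integral] with t ht htm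
    rw [(ht (uIoc_subset_uIcc htm) m left_mem_uIcc).deriv]
  have hsd : Function.support (deriv φ) ⊆ tsupport φ := support_deriv_subset
  have e2 : ∫ t in m..M, deriv φ t = 0 := by
    rw [acφ.integral_deriv_eq_sub, z1, z2, sub_zero]
  have hdc : Continuous (deriv φ) := hφ.continuous_deriv (by norm_cast)
  have hsplit : ∀ t ∈ uIcc m M, deriv φ t * ∫ r in c..t, w r
      = deriv φ t * (∫ r in c..m, w r) + deriv φ t * ∫ r in m..t, w r := by
    intro t ht
    rw [← mul_add, intervalIntegral.integral_add_adjacent_intervals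
      (LocallyIntegrableOn.intervalIntegrable hs hw hc hm)
      (LocallyIntegrableOn.intervalIntegrable hs hw hm (hs.uIcc_subset hm hM ht))]
  rw [hfull _ ((Function.support_mul_subset_left _ _).trans hsd),
    hfull _ ((Function.support_mul_subset_left _ _).trans (subset_tsupport φ)),
    intervalIntegral.integral_congr hsplit, intervalIntegral.integral_add, e1.symm, hIBP,
    intervalIntegral.integral_mul_const, e2, zero_mul, zero_add, neg_neg]
  · exact (hdc.intervalIntegrable _ _).mul_const _
  · exact (hdc.continuousOn.mul acW.continuousOn).intervalIntegrable

/-- Continuous linear functionals separate points and commute with the integrals, which reduces the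
claim to the scalar case. -/
theorem integral_deriv_smul_primitive [CompleteSpace E] {s : Set ℝ} (ho : IsOpen s)
    (hs : s.OrdConnected) {w : ℝ → E} (hw : LocallyIntegrableOn w s) {c : ℝ} (hc : c ∈ s)
    {φ : ℝ → ℝ} (hφ : ContDiff ℝ ∞ φ) (hφc : HasCompactSupport φ) (hφs : tsupport φ ⊆ s) :
    ∫ t, deriv φ t • ∫ r in c..t, w r = -∫ t, φ t • w t := by
  have hWl : LocallyIntegrableOn (fun t => ∫ r in c..t, w r) s :=
    (continuousOn_integral_of_locallyIntegrableOn ho hs hw hc).locallyIntegrableOn ho.measurableSet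
  have hdc : Continuous (deriv φ) := hφ.continuous_deriv (by norm_cast)
  have i1 := LocallyIntegrableOn.integrable_smul_of_tsupport_subset hWl hdc hφc.deriv
    (tsupport_deriv_subset_of_subset hφs)
  have i2 := LocallyIntegrableOn.integrable_smul_of_tsupport_subset hw hφ.continuous hφc hφs
  refine (SeparatingDual.eq_iff_forall_dual_eq (R := ℝ)).2 fun ℓ => ?_
  have hlw : LocallyIntegrableOn (fun t => ℓ (w t)) s := by
    intro x hx
    obtain ⟨U, hU, hUi⟩ := hw x hx
    exact ⟨U, hU, ℓ.integrable_comp hUi⟩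
  have h := integral_deriv_mul_primitive ho hs hlw hc hφ hφc hφs
  rw [map_neg, ← ℓ.integral_comp_comm i1, ← ℓ.integral_comp_comm i2]
  simp_rw [map_smul, smul_eq_mul]
  rw [← h]
  refine integral_congr_ae (Eventually.of_forall fun t => ?_)
  by_cases ht : t ∈ s
  · simp only
    rw [ℓ.intervalIntegral_comp_comm (LocallyIntegrableOn.intervalIntegrable hs hw hc ht)]
  · have : deriv φ t = 0 := image_eq_zero_of_notMem_tsupport fun h' =>
      ht (tsupport_deriv_subset_of_subset hφs h')
    simp [this]

/-- A function with a weak derivative agrees a.e. with a primitive of it. -/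
theorem HasWeakDerivOn.exists_ae_eq_add_integral [CompleteSpace E] {s : Set ℝ} (ho : IsOpen s)
    (hs : s.OrdConnected) {v w : ℝ → E} (h : HasWeakDerivOn v w s) {c : ℝ} (hc : c ∈ s) :
    ∃ a : E, ∀ᵐ t, t ∈ s → v t = a + ∫ r in c..t, w r := by
  obtain ⟨hv, hw, hφ⟩ := h
  have hWl : LocallyIntegrableOn (fun t => ∫ r in c..t, w r) s :=
    (continuousOn_integral_of_locallyIntegrableOn ho hs hw hc).locallyIntegrableOn ho.measurableSet
  obtain ⟨a, ha⟩ := exists_ae_eq_const_of_integral_deriv_smul_eq_zero ho hs (hv.sub hWl) (by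
    intro φ h1 h2 h3
    have hdc : Continuous (deriv φ) := h1.continuous_deriv (by norm_cast)
    have h3' := tsupport_deriv_subset_of_subset h3
    simp_rw [Pi.sub_apply, smul_sub]
    rw [integral_sub (LocallyIntegrableOn.integrable_smul_of_tsupport_subset hv hdc h2.deriv h3')
      (LocallyIntegrableOn.integrable_smul_of_tsupport_subset hWl hdc h2.deriv h3'),
      hφ φ h1 h2 h3, integral_deriv_smul_primitive ho hs hw hc h1 h2 h3, sub_self])
  refine ⟨a, ?_⟩
  filter_upwards [ha] with t ht hts
  rw [← ht hts, Pi.sub_apply, sub_add_cancel]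

end WeakDerivatives

end ErdelyiKober

namespace ErdelyiKober

/-! ### Weak space derivatives in L²(ℝ) and integration by parts. -/

section SpaceDerivatives

open Filter Topology

theorem L2.locallyIntegrableOn (f : L2) (s : Set ℝ) : LocallyIntegrableOn (f : ℝ → ℝ) s :=
  ((Lp.memLp f).locallyIntegrable (by norm_num)).locallyIntegrableOn s

theorem L2.integrable_mul (f g : L2) : Integrable (fun x => f x * g x) :=
  (Lp.memLp f).integrable_mul (Lp.memLp g)

theorem L2.inner_eq_integral_mul (f g : L2) : inner ℝ f g = ∫ x, f x * g x := by
  rw [MeasureTheory.L2.inner_def]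
  refine integral_congr_ae (Eventually.of_forall fun x => ?_)
  simp [mul_comm]

theorem integral_testFunction_smul {φ : ℝ → ℝ} (hφ : Continuous φ) (hc : HasCompactSupport φ) :
    ∃ p : L2, ∀ f : L2, ∫ x, φ x • f x = inner ℝ p f := by
  have hm : MemLp φ 2 volume := hφ.memLp_of_hasCompactSupport hc
  refine ⟨hm.toLp φ, fun f => ?_⟩
  rw [L2.inner_eq_integral_mul]
  refine integral_congr_ae ?_
  filter_upwards [hm.coeFn_toLp] with x hx
  rw [hx, smul_eq_mul]

theorem HasSpaceDeriv.unique {f g h : L2} (hg : HasSpaceDeriv f g) (hh : HasSpaceDeriv f h) :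
    g = h := by
  refine Lp.ext ?_
  have h1 : LocallyIntegrable (fun x => g x - h x) :=
    locallyIntegrableOn_univ.1 ((L2.locallyIntegrableOn g univ).sub (L2.locallyIntegrableOn h univ))
  have h2 := ae_eq_zero_of_integral_contDiff_smul_eq_zero h1 (fun φ h3 h4 => by
    have e1 := hg.2.2 φ h3 h4 (subset_univ _)
    have e2 := hh.2.2 φ h3 h4 (subset_univ _)
    simp_rw [smul_sub]
    rw [integral_sub, ← neg_inj, ← neg_neg (∫ x, φ x • g x), ← e1, e2, neg_neg, sub_self]
    · exact LocallyIntegrableOn.integrable_smul_of_tsupport_subset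
        (L2.locallyIntegrableOn g univ) h3.continuous h4 (subset_univ _)
    · exact LocallyIntegrableOn.integrable_smul_of_tsupport_subset
        (L2.locallyIntegrableOn h univ) h3.continuous h4 (subset_univ _))
  filter_upwards [h2] with x hx
  exact sub_eq_zero.1 hx

theorem hasSpaceDeriv_iff {f g : L2} : HasSpaceDeriv f g ↔
    ∀ φ : ℝ → ℝ, ContDiff ℝ ∞ φ → HasCompactSupport φ →
      ∫ t, deriv φ t • f t = -∫ t, φ t • g t :=
  ⟨fun h φ h1 h2 => h.2.2 φ h1 h2 (subset_univ _), fun h =>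
    ⟨L2.locallyIntegrableOn f univ, L2.locallyIntegrableOn g univ, fun φ h1 h2 _ => h φ h1 h2⟩⟩

/-- The graph of the weak derivative is closed: both sides of the defining identity are inner
products with fixed elements of L². -/
theorem HasSpaceDeriv.of_tendsto {ι : Type*} {l : Filter ι} [l.NeBot] {F G : ι → L2} {f g : L2}
    (h : ∀ᶠ i in l, HasSpaceDeriv (F i) (G i)) (hF : Tendsto F l (𝓝 f)) (hG : Tendsto G l (𝓝 g)) :
    HasSpaceDeriv f g := by
  rw [hasSpaceDeriv_iff]
  intro φ h1 h2
  obtain ⟨p, hp⟩ := integral_testFunction_smul h1.continuous h2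
  obtain ⟨q, hq⟩ := integral_testFunction_smul (h1.continuous_deriv (by norm_cast)) h2.deriv
  rw [hp, hq]
  refine tendsto_nhds_unique_of_eventuallyEq (tendsto_const_nhds.inner hF)
    (tendsto_const_nhds.inner hG).neg ?_
  filter_upwards [h] with i hi
  rw [← hp, ← hq]
  exact hi.2.2 φ h1 h2 (subset_univ _)

theorem HasSpaceDeriv.sub {f g f' g' : L2} (h : HasSpaceDeriv f g) (h' : HasSpaceDeriv f' g') :
    HasSpaceDeriv (f - f') (g - g') := by
  rw [hasSpaceDeriv_iff]
  intro φ h1 h2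
  obtain ⟨p, hp⟩ := integral_testFunction_smul h1.continuous h2
  obtain ⟨q, hq⟩ := integral_testFunction_smul (h1.continuous_deriv (by norm_cast)) h2.deriv
  have e1 := h.2.2 φ h1 h2 (subset_univ _)
  have e2 := h'.2.2 φ h1 h2 (subset_univ _)
  rw [hp, hq] at e1 e2
  rw [hp, hq, inner_sub_right, inner_sub_right, e1, e2]
  ring

/-- The product of the absolutely continuous representatives has an integrable derivative, hence
limits at ±∞. Being itself integrable, it can only tend to 0, so the integral of (fχ)' vanishes. -/
theorem HasSpaceDeriv.inner_deriv_right {f g χ χx : L2} (h : HasSpaceDeriv f g)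
    (h' : HasSpaceDeriv χ χx) : inner ℝ f χx = -inner ℝ g χ := by
  obtain ⟨a, ha⟩ := HasWeakDerivOn.exists_ae_eq_add_integral isOpen_univ ordConnected_univ h
    (mem_univ (0 : ℝ))
  obtain ⟨b, hb⟩ := HasWeakDerivOn.exists_ae_eq_add_integral isOpen_univ ordConnected_univ h'
    (mem_univ (0 : ℝ))
  set F : ℝ → ℝ := fun t => a + ∫ r in (0 : ℝ)..t, g r with hF
  set X : ℝ → ℝ := fun t => b + ∫ r in (0 : ℝ)..t, χx r with hX
  have hgi : ∀ u v : ℝ, IntervalIntegrable g volume u v := fun u v =>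
    LocallyIntegrableOn.intervalIntegrable ordConnected_univ (L2.locallyIntegrableOn g univ)
      (mem_univ _) (mem_univ _)
  have hxi : ∀ u v : ℝ, IntervalIntegrable χx volume u v := fun u v =>
    LocallyIntegrableOn.intervalIntegrable ordConnected_univ (L2.locallyIntegrableOn χx univ)
      (mem_univ _) (mem_univ _)
  have hFae : ∀ᵐ t, f t = F t := by filter_upwards [ha] with t ht using ht (mem_univ _)
  have hXae : ∀ᵐ t, χ t = X t := by filter_upwards [hb] with t ht using ht (mem_univ _)
  have acF : ∀ R : ℝ, 0 ≤ R → AbsolutelyContinuousOnInterval F (-R) R := fun R hR => by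
    refine AbsolutelyContinuousOnInterval.add ?_ ?_
    · exact (LipschitzWith.const a).lipschitzOnWith.absolutelyContinuousOnInterval
    · exact (hgi _ _).absolutelyContinuousOnInterval_intervalIntegral
        (by rw [uIcc_of_le (by linarith)]; exact ⟨by linarith, hR⟩)
  have acX : ∀ R : ℝ, 0 ≤ R → AbsolutelyContinuousOnInterval X (-R) R := fun R hR => by
    refine AbsolutelyContinuousOnInterval.add ?_ ?_
    · exact (LipschitzWith.const b).lipschitzOnWith.absolutelyContinuousOnInterval
    · exact (hxi _ _).absolutelyContinuousOnInterval_intervalIntegral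
        (by rw [uIcc_of_le (by linarith)]; exact ⟨by linarith, hR⟩)
  set q : ℝ → ℝ := fun t => g t * χ t + f t * χx t with hq
  have hqi : Integrable q := (L2.integrable_mul g χ).add (L2.integrable_mul f χx)
  have hint : ∀ u v : ℝ, ∫ t in u..v, q t = F v * X v - F u * X u := by
    intro u v
    set R := max |u| |v| with hR
    have hR0 : 0 ≤ R := (abs_nonneg u).trans (le_max_left _ _)
    have hu := abs_le.1 (le_max_left |u| |v|)
    have hv := abs_le.1 (le_max_right |u| |v|)
    have hsub : uIcc u v ⊆ uIcc (-R) R := by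
      refine uIcc_subset_uIcc ?_ ?_ <;> rw [uIcc_of_le (by linarith)]
      · exact hu
      · exact hv
    rw [← (((acF R hR0).mono hsub).integral_deriv_mul_eq_sub ((acX R hR0).mono hsub))]
    refine intervalIntegral.integral_congr_ae ?_
    filter_upwards [hFae, hXae, (hgi u v).ae_hasDerivAt_integral,
      (hxi u v).ae_hasDerivAt_integral] with t h1 h2 h3 h4 ht
    have ht' := uIoc_subset_uIcc ht
    have d1 : HasDerivAt F (g t) t := by
      have := (h3 ht' u left_mem_uIcc).const_add (a + ∫ r in (0 : ℝ)..u, g r)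
      refine this.congr_of_eventuallyEq (Eventually.of_forall fun y => ?_)
      simp only [hF]
      rw [add_assoc, intervalIntegral.integral_add_adjacent_intervals (hgi _ _) (hgi _ _)]
    have d2 : HasDerivAt X (χx t) t := by
      have := (h4 ht' u left_mem_uIcc).const_add (b + ∫ r in (0 : ℝ)..u, χx r)
      refine this.congr_of_eventuallyEq (Eventually.of_forall fun y => ?_)
      simp only [hX]
      rw [add_assoc, intervalIntegral.integral_add_adjacent_intervals (hxi _ _) (hxi _ _)]
    rw [d1.deriv, d2.deriv, hq]
    simp only [h1, h2]
  have hpi : Integrable (fun t => F t * X t) := by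
    refine (L2.integrable_mul f χ).congr ?_
    filter_upwards [hFae, hXae] with t h1 h2
    rw [h1, h2]
  have htop : Tendsto (fun t => F t * X t) atTop
      (𝓝 (F 0 * X 0 + ∫ t in Ioi (0 : ℝ), q t)) := by
    have := (intervalIntegral_tendsto_integral_Ioi 0 hqi.integrableOn tendsto_id).const_add
      (F 0 * X 0)
    refine this.congr fun t => ?_
    rw [id, hint]; ring
  have hbot : Tendsto (fun t => F t * X t) atBot
      (𝓝 (F 0 * X 0 - ∫ t in Iic (0 : ℝ), q t)) := by
    have := (intervalIntegral_tendsto_integral_Iic 0 hqi.integrableOn tendsto_id).const_sub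
      (F 0 * X 0)
    refine this.congr fun t => ?_
    rw [id, hint]; ring
  have z1 := (hpi.integrableAtFilter atTop).eq_zero_of_tendsto (fun s hs => by
    obtain ⟨c, hc⟩ := mem_atTop_sets.1 hs
    exact measure_mono_top (fun x hx => hc x hx) (Real.volume_Ici (a := c))) htop
  have z2 := (hpi.integrableAtFilter atBot).eq_zero_of_tendsto (fun s hs => by
    obtain ⟨c, hc⟩ := mem_atBot_sets.1 hs
    exact measure_mono_top (fun x hx => hc x hx) (Real.volume_Iic (a := c))) hbot
  have htot : ∫ t, q t = 0 := by
    rw [← intervalIntegral.integral_Iic_add_Ioi (b := 0) hqi.integrableOn hqi.integrableOn]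
    linarith
  rw [hq, integral_add (L2.integrable_mul g χ) (L2.integrable_mul f χx)] at htot
  rw [L2.inner_eq_integral_mul, L2.inner_eq_integral_mul]
  linarith

end SpaceDerivatives

end ErdelyiKober

namespace ErdelyiKober

/-! ### The kernel, its monotonicity and the quadrature weights. -/

section Kernel

/-- The constant `1 / (β Γ(β))`, the integral of the kernel over `[0, 1]`. -/
noncomputable def kappa (β : ℝ) : ℝ := 1 / (β * Real.Gamma β)

/-- The kernel of `φ ↦ t^α I_{α/β}^{0,β} φ(t)`. -/
noncomputable def kernel (α β t s : ℝ) : ℝ :=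
  α / β / Real.Gamma β * (s ^ (α / β - 1) * (t ^ (α / β) - s ^ (α / β)) ^ (β - 1))

/-- The integral of `kernel α β n` over `[j, j + 1]`. -/
noncomputable def weight (α β : ℝ) (n j : ℕ) : ℝ :=
  kappa β * (((n : ℝ) ^ (α / β) - (j : ℝ) ^ (α / β)) ^ β -
    ((n : ℝ) ^ (α / β) - ((j : ℝ) + 1) ^ (α / β)) ^ β)

variable {α β : ℝ}

theorem kappa_pos (hβ : 0 < β) : 0 < kappa β :=
  one_div_pos.2 (mul_pos hβ (Real.Gamma_pos_of_pos hβ))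

theorem kernel_nonneg (hα : 0 < α) (hβ : 0 < β) {t s : ℝ} (hs : 0 ≤ s) (hst : s ≤ t) :
    0 ≤ kernel α β t s := by
  have h1 := Real.rpow_le_rpow hs hst (div_pos hα hβ).le
  have h2 := Real.Gamma_pos_of_pos hβ
  have h3 : 0 ≤ t ^ (α / β) - s ^ (α / β) := sub_nonneg.2 h1
  unfold kernel
  positivity

/-- The power `s^(α/β-1)` is, up to a factor, the inner derivative of `t^(α/β) - s^(α/β)`. This
explicit primitive makes the weights closed expressions and their sums telescoping. -/
theorem hasDerivAt_kernel_primitive (hα : 0 < α) (hβ : 0 < β) {t s : ℝ} (hs : 0 < s)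
    (hst : s < t) :
    HasDerivAt (fun r => -(kappa β * (t ^ (α / β) - r ^ (α / β)) ^ β)) (kernel α β t s) s := by
  have h0 : 0 < t ^ (α / β) - s ^ (α / β) :=
    sub_pos.2 (Real.rpow_lt_rpow hs.le hst (div_pos hα hβ))
  have h1 := (Real.hasDerivAt_rpow_const (p := α / β) (Or.inl hs.ne')).const_sub (t ^ (α / β))
  have h2 := ((h1.rpow_const (p := β) (Or.inl h0.ne')).const_mul (kappa β)).neg
  refine h2.congr_deriv ?_
  have hΓ := (Real.Gamma_pos_of_pos hβ).ne'
  unfold kernel kappa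
  field_simp

theorem continuous_kernel_primitive (hα : 0 < α) (hβ : 0 < β) (t : ℝ) :
    Continuous (fun r : ℝ => -(kappa β * (t ^ (α / β) - r ^ (α / β)) ^ β)) :=
  (continuous_const.mul ((continuous_const.sub
    (Real.continuous_rpow_const (div_pos hα hβ).le)).rpow_const fun _ => Or.inr hβ.le)).neg

theorem intervalIntegrable_kernel (hα : 0 < α) (hβ : 0 < β) {t a b : ℝ} (ha : 0 ≤ a)
    (hab : a ≤ b) (hbt : b ≤ t) : IntervalIntegrable (kernel α β t) volume a b := by
  refine intervalIntegral.intervalIntegrable_deriv_of_nonneg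
    (continuous_kernel_primitive hα hβ t).continuousOn ?_ ?_ <;>
    rw [min_eq_left hab, max_eq_right hab]
  · exact fun x hx => hasDerivAt_kernel_primitive hα hβ (ha.trans_lt hx.1) (hx.2.trans_le hbt)
  · exact fun x hx => kernel_nonneg hα hβ (ha.trans hx.1.le) (hx.2.le.trans hbt)

theorem integral_kernel (hα : 0 < α) (hβ : 0 < β) {t a b : ℝ} (ha : 0 ≤ a)
    (hab : a ≤ b) (hbt : b ≤ t) : ∫ s in a..b, kernel α β t s =
      kappa β * ((t ^ (α / β) - a ^ (α / β)) ^ β - (t ^ (α / β) - b ^ (α / β)) ^ β) := by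
  rw [intervalIntegral.integral_eq_sub_of_hasDerivAt_of_le hab
    (continuous_kernel_primitive hα hβ t).continuousOn
    (fun x hx => hasDerivAt_kernel_primitive hα hβ (ha.trans_lt hx.1) (hx.2.trans_le hbt))
    (intervalIntegrable_kernel hα hβ ha hab hbt)]
  ring

theorem rpow_div_rpow (hβ : 0 < β) {t : ℝ} (ht : 0 ≤ t) : (t ^ (α / β)) ^ β = t ^ α := by
  rw [← Real.rpow_mul ht, div_mul_cancel₀ _ hβ.ne']

theorem integral_kernel_full (hα : 0 < α) (hβ : 0 < β) {t : ℝ} (ht : 0 ≤ t) :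
    ∫ s in 0..t, kernel α β t s = kappa β * t ^ α := by
  rw [integral_kernel hα hβ le_rfl ht le_rfl, Real.zero_rpow (div_pos hα hβ).ne', sub_zero,
    sub_self, Real.zero_rpow hβ.ne', sub_zero, rpow_div_rpow hβ ht]

/-- Homogeneity is what allows the step size k to be scaled to 1. -/
theorem kernel_mul (hα : 0 < α) (hβ : 0 < β) {k t s : ℝ} (hk : 0 < k) (hs : 0 ≤ s)
    (hst : s ≤ t) : kernel α β (k * t) (k * s) = k ^ (α - 1) * kernel α β t s := by
  have h1 := Real.rpow_le_rpow hs hst (div_pos hα hβ).le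
  have h3 : 0 ≤ t ^ (α / β) - s ^ (α / β) := sub_nonneg.2 h1
  have hkη : 0 ≤ k ^ (α / β) := (Real.rpow_pos_of_pos hk _).le
  unfold kernel
  rw [Real.mul_rpow hk.le hs, Real.mul_rpow hk.le hs, Real.mul_rpow hk.le (hs.trans hst),
    ← mul_sub, Real.mul_rpow hkη h3, ← Real.rpow_mul hk.le]
  have : k ^ (α - 1) = k ^ (α / β - 1) * k ^ (α / β * (β - 1)) := by
    rw [← Real.rpow_add hk]
    congr 1
    field_simp
    ring
  rw [this]
  ring

theorem kernel_le_kernel_of_le (hα : 0 < α) (hβ : 0 < β) (hβ1 : β < 1) {t t' s : ℝ} (hs : 0 ≤ s)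
    (hst : s < t) (htt : t ≤ t') : kernel α β t' s ≤ kernel α β t s := by
  have hη := div_pos hα hβ
  have h1 := Real.rpow_lt_rpow hs hst hη
  have h2 := Real.rpow_le_rpow (hs.trans hst.le) htt hη.le
  have h3 := Real.Gamma_pos_of_pos hβ
  have h4 : (t' ^ (α / β) - s ^ (α / β)) ^ (β - 1) ≤ (t ^ (α / β) - s ^ (α / β)) ^ (β - 1) :=
    Real.rpow_le_rpow_of_nonpos (sub_pos.2 h1) (by linarith) (by linarith)
  unfold kernel
  gcongr

theorem kernel_le_kernel_right (hα : 0 < α) (hβ : 0 < β) (hβ1 : β < 1) (hη1 : 1 ≤ α / β)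
    {t s s' : ℝ} (hs : 0 ≤ s) (hss : s ≤ s') (hst : s' < t) :
    kernel α β t s ≤ kernel α β t s' := by
  have hη := div_pos hα hβ
  have h1 := Real.rpow_lt_rpow (hs.trans hss) hst hη
  have h2 := Real.rpow_le_rpow hs hss hη.le
  have h3 := Real.Gamma_pos_of_pos hβ
  have h5 : s ^ (α / β - 1) ≤ s' ^ (α / β - 1) := Real.rpow_le_rpow hs hss (by linarith)
  have h4 : (t ^ (α / β) - s ^ (α / β)) ^ (β - 1) ≤ (t ^ (α / β) - s' ^ (α / β)) ^ (β - 1) :=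
    Real.rpow_le_rpow_of_nonpos (sub_pos.2 h1) (by linarith) (by linarith)
  have h6 : 0 ≤ t ^ (α / β) - s ^ (α / β) := by linarith
  unfold kernel
  gcongr
  exact Real.rpow_nonneg (hs.trans hss) _

/-- The ratio of the derivatives of (v+1)^η and v^η is ((v+1)/v)^(η-1), which for η ≥ 1 is largest
at the left end v = s. -/
theorem rpow_add_one_sub_le {η s t : ℝ} (hη : 1 ≤ η) (hs : 0 < s) (hst : s ≤ t) :
    (t + 1) ^ η - (s + 1) ^ η ≤ ((s + 1) / s) ^ (η - 1) * (t ^ η - s ^ η) := by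
  set c := ((s + 1) / s) ^ (η - 1) with hc
  have hmono : MonotoneOn (fun v : ℝ => c * v ^ η - (v + 1) ^ η) (Ici s) := by
    have hd : ∀ v : ℝ, 0 < v → HasDerivAt (fun v : ℝ => c * v ^ η - (v + 1) ^ η)
        (c * (η * v ^ (η - 1)) - 1 * η * (v + 1) ^ (η - 1)) v := fun v hv =>
      ((Real.hasDerivAt_rpow_const (Or.inr hη)).const_mul c).sub
        (((hasDerivAt_id v).add_const 1).rpow_const (Or.inr hη))
    refine monotoneOn_of_deriv_nonneg (convex_Ici s) ?_ ?_ ?_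
    · exact fun v hv => (hd v (hs.trans_le hv)).continuousAt.continuousWithinAt
    · exact fun v hv => (hd v (hs.trans_le (interior_subset hv))).differentiableAt.differentiableWithinAt
    · intro v hv
      have hsv : s ≤ v := interior_subset hv
      have hv0 : 0 < v := hs.trans_le hsv
      rw [(hd v hv0).deriv]
      have h1 : (v + 1) ^ (η - 1) ≤ c * v ^ (η - 1) := by
        rw [hc, ← Real.mul_rpow (by positivity) hv0.le]
        refine Real.rpow_le_rpow (by positivity) ?_ (by linarith)
        rw [div_mul_eq_mul_div, le_div_iff₀ hs]
        nlinarith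
      nlinarith
  have h := hmono (self_mem_Ici) (show t ∈ Ici s from hst) hst
  simp only at h
  linarith

/-- With c = ((s+1)/s)^(η-1) ≥ 1, the diagonal shift multiplies the power of s by c, while the
singular factor shrinks at most by c^(β-1). The net factor is at least c^β ≥ 1. -/
theorem kernel_le_kernel_add_one (hα : 0 < α) (hβ : 0 < β) (hβ1 : β < 1) (hη1 : 1 ≤ α / β)
    {t s : ℝ} (hs : 0 ≤ s) (hst : s < t) :
    kernel α β t s ≤ kernel α β (t + 1) (s + 1) := by
  set η := α / β with hηdef
  have hη := div_pos hα hβ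
  -- At s = 0 the ratio (s+1)/s is not available. For η = 1 the two sides are equal, and for η > 1
  -- the left one is 0.
  rcases hs.eq_or_lt with rfl | hs0
  · rcases hη1.eq_or_lt with h1 | h1
    · unfold kernel
      rw [← hηdef, ← h1]
      simp
    · have h0 := kernel_nonneg hα hβ (show (0 : ℝ) ≤ 0 + 1 by norm_num)
        (show (0 : ℝ) + 1 ≤ t + 1 by linarith)
      refine le_trans (le_of_eq ?_) h0
      unfold kernel
      rw [Real.zero_rpow (by linarith : α / β - 1 ≠ 0)]
      simp
  have hA : 0 < t ^ η - s ^ η := sub_pos.2 (Real.rpow_lt_rpow hs hst hη)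
  have hB : 0 < (t + 1) ^ η - (s + 1) ^ η :=
    sub_pos.2 (Real.rpow_lt_rpow (by linarith) (by linarith) hη)
  have hΓ := Real.Gamma_pos_of_pos hβ
  set c := ((s + 1) / s) ^ (η - 1) with hc
  have hc1 : 1 ≤ c := Real.one_le_rpow (by rw [le_div_iff₀ hs0]; linarith) (by linarith)
  have hBA := rpow_add_one_sub_le hη1 hs0 hst.le
  have h1 : c ^ (β - 1) * (t ^ η - s ^ η) ^ (β - 1) ≤ ((t + 1) ^ η - (s + 1) ^ η) ^ (β - 1) := by
    rw [← Real.mul_rpow (by linarith) hA.le]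
    exact Real.rpow_le_rpow_of_nonpos hB hBA (by linarith)
  have h2 : 1 ≤ c * c ^ (β - 1) := by
    rw [← Real.rpow_one_add' (by linarith) (by linarith)]
    exact Real.one_le_rpow hc1 (by linarith)
  have h3 : (s + 1) ^ (η - 1) = c * s ^ (η - 1) := by
    rw [hc, ← Real.mul_rpow (by positivity) hs, div_mul_cancel₀ _ hs0.ne']
  have h4 : s ^ (η - 1) * (t ^ η - s ^ η) ^ (β - 1) ≤
      (s + 1) ^ (η - 1) * ((t + 1) ^ η - (s + 1) ^ η) ^ (β - 1) := by
    rw [h3]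
    have h5 : 0 ≤ s ^ (η - 1) * (t ^ η - s ^ η) ^ (β - 1) := by positivity
    calc s ^ (η - 1) * (t ^ η - s ^ η) ^ (β - 1)
        ≤ (c * c ^ (β - 1)) * (s ^ (η - 1) * (t ^ η - s ^ η) ^ (β - 1)) :=
          le_mul_of_one_le_left h5 h2
      _ = c * s ^ (η - 1) * (c ^ (β - 1) * (t ^ η - s ^ η) ^ (β - 1)) := by ring
      _ ≤ _ := by gcongr
  unfold kernel
  gcongr

theorem weight_eq_integral (hα : 0 < α) (hβ : 0 < β) {n j : ℕ} (hj : j < n) :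
    weight α β n j = ∫ s in (j : ℝ)..(j + 1 : ℝ), kernel α β n s := by
  have h : (j : ℝ) + 1 ≤ n := by exact_mod_cast hj
  rw [integral_kernel hα hβ (Nat.cast_nonneg j) (by linarith) h]
  rfl

theorem weight_nonneg (hα : 0 < α) (hβ : 0 < β) {n j : ℕ} (hj : j < n) : 0 ≤ weight α β n j := by
  have h : (j : ℝ) + 1 ≤ n := by exact_mod_cast hj
  rw [weight_eq_integral hα hβ hj]
  exact intervalIntegral.integral_nonneg (by linarith) fun s hs =>
    kernel_nonneg hα hβ ((Nat.cast_nonneg j).trans hs.1) (hs.2.trans h)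

theorem sum_weight_range (n m : ℕ) : ∑ j ∈ Finset.range m, weight α β n j =
    kappa β * (((n : ℝ) ^ (α / β) - (0 : ℝ) ^ (α / β)) ^ β -
      ((n : ℝ) ^ (α / β) - (m : ℝ) ^ (α / β)) ^ β) := by
  induction m with
  | zero => simp
  | succ m ih => rw [Finset.sum_range_succ, ih, weight]; push_cast; ring

theorem sum_weight (hα : 0 < α) (hβ : 0 < β) (n : ℕ) :
    ∑ j ∈ Finset.range n, weight α β n j = kappa β * (n : ℝ) ^ α := by
  rw [sum_weight_range, Real.zero_rpow (div_pos hα hβ).ne', sub_zero, sub_self,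
    Real.zero_rpow hβ.ne', sub_zero, rpow_div_rpow hβ (Nat.cast_nonneg n)]

theorem weight_succ_le (hα : 0 < α) (hβ : 0 < β) (hβ1 : β < 1) {n j : ℕ} (hj : j < n) :
    weight α β (n + 1) j ≤ weight α β n j := by
  have h : (j : ℝ) + 1 ≤ n := by exact_mod_cast hj
  rw [weight_eq_integral hα hβ hj, weight_eq_integral hα hβ (hj.trans n.lt_succ_self)]
  refine intervalIntegral.integral_mono_on_of_le_Ioo (by linarith)
    (intervalIntegrable_kernel hα hβ (Nat.cast_nonneg j) (by linarith) (by push_cast; linarith))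
    (intervalIntegrable_kernel hα hβ (Nat.cast_nonneg j) (by linarith) h) fun s hs => ?_
  exact kernel_le_kernel_of_le hα hβ hβ1 ((Nat.cast_nonneg j).trans hs.1.le) (by linarith [hs.2])
    (by push_cast; linarith)

theorem weight_le_weight_succ_right (hα : 0 < α) (hβ : 0 < β) (hβ1 : β < 1) (hη1 : 1 ≤ α / β)
    {n j : ℕ} (hj : j + 1 < n) : weight α β n j ≤ weight α β n (j + 1) := by
  have h : (j : ℝ) + 1 + 1 ≤ n := by exact_mod_cast hj
  rw [weight_eq_integral hα hβ hj, weight_eq_integral hα hβ (by omega : j < n)]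
  push_cast
  rw [← intervalIntegral.integral_comp_add_right (fun s => kernel α β n s) 1]
  have hi := intervalIntegrable_kernel (t := n) hα hβ (a := (j : ℝ) + 1) (b := (j : ℝ) + 1 + 1) (by positivity)
    (by linarith) h
  refine intervalIntegral.integral_mono_on_of_le_Ioo (by linarith)
    (intervalIntegrable_kernel hα hβ (Nat.cast_nonneg j) (by linarith) (by linarith))
    (by simpa using hi.comp_add_right 1) fun s hs => ?_
  exact kernel_le_kernel_right hα hβ hβ1 hη1 ((Nat.cast_nonneg j).trans hs.1.le) (by linarith)
    (by linarith [hs.2])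

/-- For α ≥ β the weights increase with the cell, so each of the n - j weights from cell j onwards
is at least the one at j, and together they are at most the full mass. -/
theorem mul_weight_le (hα : 0 < α) (hβ : 0 < β) (hβ1 : β < 1) (hη1 : 1 ≤ α / β) {n j : ℕ}
    (hj : j < n) : ((n : ℝ) - j) * weight α β n j ≤ kappa β * (n : ℝ) ^ α := by
  have hmono : ∀ i, j ≤ i → i < n → weight α β n j ≤ weight α β n i := by
    intro i hji
    induction i, hji using Nat.le_induction with
    | base => exact fun _ => le_rfl
    | succ i hi ih => exact fun h =>
        (ih (by omega)).trans (weight_le_weight_succ_right hα hβ hβ1 hη1 h)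
  rw [← sum_weight hα hβ n]
  calc ((n : ℝ) - j) * weight α β n j = ∑ i ∈ Finset.Ico j n, weight α β n j := by
        rw [Finset.sum_const, Nat.card_Ico, nsmul_eq_mul, Nat.cast_sub hj.le]
    _ ≤ ∑ i ∈ Finset.Ico j n, weight α β n i :=
        Finset.sum_le_sum fun i hi => hmono i (Finset.mem_Ico.1 hi).1 (Finset.mem_Ico.1 hi).2
    _ ≤ ∑ i ∈ Finset.range n, weight α β n i := by
        refine Finset.sum_le_sum_of_subset_of_nonneg ?_ fun i hi _ =>
          weight_nonneg hα hβ (Finset.mem_range.1 hi)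
        intro i hi
        exact Finset.mem_range.2 (Finset.mem_Ico.1 hi).2

end Kernel

end ErdelyiKober

namespace ErdelyiKober

/-! ### Time increments of the error of the rectangle rule. -/

section Quadrature

variable {E : Type*} [NormedAddCommGroup E] [NormedSpace ℝ E] {α β : ℝ}

/-- `t^α I_{α/β}^{0,β} f(t)`. -/
noncomputable def kernelIntegral (α β : ℝ) (f : ℝ → E) (t : ℝ) : E :=
  ∫ s in (0 : ℝ)..t, kernel α β t s • f s

/-- The rectangle rule for `kernelIntegral`, where `φ j` is the value on `(j, j + 1]`. -/
noncomputable def weightedSum (α β : ℝ) (φ : ℕ → E) (n : ℕ) : E :=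
  ∑ j ∈ Finset.range n, weight α β n j • φ j

/-- The contribution of `[j, j + 1]` to the error of the rectangle rule. -/
noncomputable def cellError (α β : ℝ) (f : ℝ → E) (n j : ℕ) : E :=
  ∫ s in (j : ℝ)..(j + 1 : ℝ), kernel α β n s • (f s - f (j + 1))

theorem norm_integral_smul_le {p : ℝ → ℝ} {g : ℝ → E} {a b M : ℝ} (hab : a ≤ b)
    (hp : IntervalIntegrable p volume a b) (hp0 : ∀ s ∈ Ioo a b, 0 ≤ p s)
    (hg : ∀ s ∈ Ioo a b, ‖g s‖ ≤ M) : ‖∫ s in a..b, p s • g s‖ ≤ M * ∫ s in a..b, p s := by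
  rw [← intervalIntegral.integral_const_mul]
  refine intervalIntegral.norm_integral_le_of_norm_le hab ?_ (hp.const_mul M)
  have hne : ∀ᵐ s : ℝ, s ≠ b := by simp [ae_iff, measure_singleton]
  filter_upwards [hne] with s hs hsab
  have hs' : s ∈ Ioo a b := ⟨hsab.1, lt_of_le_of_ne hsab.2 hs⟩
  rw [norm_smul, Real.norm_of_nonneg (hp0 s hs'), mul_comm]
  exact mul_le_mul_of_nonneg_right (hg s hs') (hp0 s hs')

theorem intervalIntegrable_kernel_smul (hα : 0 < α) (hβ : 0 < β) {t a b : ℝ} (ha : 0 ≤ a)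
    (hab : a ≤ b) (hbt : b ≤ t) {f : ℝ → E} (hf : Continuous f) :
    IntervalIntegrable (fun s => kernel α β t s • f s) volume a b :=
  (intervalIntegrable_kernel hα hβ ha hab hbt).smul_continuousOn hf.continuousOn

theorem kernelIntegral_sub_weightedSum [CompleteSpace E] (hα : 0 < α) (hβ : 0 < β) {f : ℝ → E}
    (hf : Continuous f) (n : ℕ) :
    kernelIntegral α β f n - weightedSum α β (fun j => f (j + 1)) n =
      ∑ j ∈ Finset.range n, cellError α β f n j := by
  have hle : ∀ j, j < n → (j : ℝ) + 1 ≤ n := fun j hj => by exact_mod_cast hj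
  have h1 : kernelIntegral α β f n =
      ∑ j ∈ Finset.range n, ∫ s in (j : ℝ)..(j + 1 : ℝ), kernel α β n s • f s := by
    have := intervalIntegral.sum_integral_adjacent_intervals (μ := volume)
      (f := fun s => kernel α β n s • f s) (a := fun j : ℕ => (j : ℝ)) (n := n) (fun j hj => by
        simp only [Nat.cast_add, Nat.cast_one]
        exact intervalIntegrable_kernel_smul hα hβ (Nat.cast_nonneg j) (by linarith)
          (hle j hj) hf)
    simp only [Nat.cast_add, Nat.cast_one, Nat.cast_zero] at this
    rw [this, kernelIntegral]
  rw [h1, weightedSum, ← Finset.sum_sub_distrib]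
  refine Finset.sum_congr rfl fun j hj => ?_
  have hj := Finset.mem_range.1 hj
  rw [weight_eq_integral hα hβ hj, ← intervalIntegral.integral_smul_const,
    ← intervalIntegral.integral_sub, cellError]
  · simp_rw [smul_sub]
  · exact intervalIntegrable_kernel_smul hα hβ (Nat.cast_nonneg j) (by linarith) (hle j hj) hf
  · exact intervalIntegrable_kernel_smul hα hβ (Nat.cast_nonneg j) (by linarith) (hle j hj)
      continuous_const

theorem rpow_sub_rpow_sub_one_le {a x : ℝ} (ha : 0 < a) (ha1 : a ≤ 1) (hx : 0 ≤ x) :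
    (x + 1) ^ a - x ^ a ≤ (x + 1) ^ (a - 1) := by
  rcases hx.eq_or_lt with rfl | hx0
  · simp [Real.zero_rpow ha.ne']
  have h1 : (x + 1) ^ (a - 1) ≤ x ^ (a - 1) :=
    Real.rpow_le_rpow_of_nonpos hx0 (by linarith) (by linarith)
  have h2 : x ^ a = x ^ (a - 1) * x := by
    rw [← Real.rpow_add_one hx0.ne', sub_add_cancel]
  have h3 : (x + 1) ^ a = (x + 1) ^ (a - 1) * (x + 1) := by
    rw [← Real.rpow_add_one (by linarith), sub_add_cancel]
  rw [h2, h3]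
  nlinarith

theorem rpow_add_one_sub_rpow_antitone {a x y : ℝ} (ha : 0 ≤ a) (ha1 : a ≤ 1) (hx : 0 ≤ x)
    (hxy : x ≤ y) : (y + 1) ^ a - y ^ a ≤ (x + 1) ^ a - x ^ a := by
  have hd : ∀ v : ℝ, 0 < v → HasDerivAt (fun v : ℝ => (v + 1) ^ a - v ^ a)
      (1 * a * (v + 1) ^ (a - 1) - a * v ^ (a - 1)) v := fun v hv =>
    (((hasDerivAt_id v).add_const 1).rpow_const (Or.inl (by simp only [id]; linarith))).sub
      (Real.hasDerivAt_rpow_const (Or.inl hv.ne'))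
  refine antitoneOn_of_deriv_nonpos (convex_Ici (0 : ℝ)) (f := fun v : ℝ => (v + 1) ^ a - v ^ a)
    ?_ ?_ ?_ hx (hx.trans hxy) hxy
  · exact (((continuous_id.add continuous_const).rpow_const fun _ => Or.inr ha).sub
      (continuous_id.rpow_const fun _ => Or.inr ha)).continuousOn
  · rw [interior_Ici]
    exact fun v hv => (hd v hv).differentiableAt.differentiableWithinAt
  · rw [interior_Ici]
    intro v hv
    have hv : 0 < v := hv
    rw [(hd v hv).deriv]
    have := Real.rpow_le_rpow_of_nonpos hv (by linarith : v ≤ v + 1) (by linarith : a - 1 ≤ 0)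
    nlinarith

/-- Abel summation: it reduces a first moment to partial sums, which are explicit for the weights.
-/
theorem sum_sub_mul_eq_sum_sum (a : ℕ → ℝ) (m : ℕ) :
    ∑ j ∈ Finset.range m, ((m : ℝ) - j) * a j =
      ∑ l ∈ Finset.range m, ∑ j ∈ Finset.range (l + 1), a j := by
  induction m with
  | zero => simp
  | succ m ih =>
    rw [Finset.sum_range_succ (fun l => ∑ j ∈ Finset.range (l + 1), a j), ← ih,
      Finset.sum_range_succ, Finset.sum_range_succ a, ← add_assoc, ← Finset.sum_add_distrib]
    push_cast
    congr 1
    · exact Finset.sum_congr rfl fun j _ => by ring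
    · ring

/-- Moment bound for the differences in `n` of the weights, for `α ≤ β`. -/
theorem sum_rpow_mul_weight_sub_le (hα : 0 < α) (hα1 : α < 1) (hβ : 0 < β) (hβ1 : β < 1)
    (hη1 : α / β ≤ 1) (m : ℕ) :
    ∑ j ∈ Finset.range m, ((j : ℝ) + 1) ^ (α - 1) * (weight α β m j - weight α β (m + 1) j) +
      ((m : ℝ) + 1) ^ (α - 1) * weight α β (m + 1) m ≤ 3 * kappa β * ((m : ℝ) + 1) ^ (α - 1) := by
  have hη := div_pos hα hβ
  have hκ := kappa_pos hβ
  have hm0 : (0 : ℝ) ≤ m := Nat.cast_nonneg m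
  set Δ : ℕ → ℝ := fun j => weight α β m j - weight α β (m + 1) j with hΔ
  have hΔ0 : ∀ j ∈ Finset.range m, 0 ≤ Δ j := fun j hj =>
    sub_nonneg.2 (weight_succ_le hα hβ hβ1 (Finset.mem_range.1 hj))
  have hpow : ∀ x : ℝ, 0 ≤ x → (x + 1) ^ (α - 1) ≤ 1 := fun x hx =>
    Real.rpow_le_one_of_one_le_of_nonpos (by linarith) (by linarith)
  have hlast : weight α β (m + 1) m ≤ kappa β := by
    unfold weight
    push_cast
    rw [sub_self, Real.zero_rpow hβ.ne', sub_zero]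
    refine mul_le_of_le_one_right hκ.le (Real.rpow_le_one ?_ ?_ hβ.le)
    · exact sub_nonneg.2 (Real.rpow_le_rpow hm0 (by linarith) hη.le)
    · exact (rpow_sub_rpow_sub_one_le hη hη1 hm0).trans
        (Real.rpow_le_one_of_one_le_of_nonpos (by linarith) (by linarith))
  have hsum : ∑ j ∈ Finset.range m, Δ j ≤ kappa β := by
    have h1 := sum_weight hα hβ (m + 1)
    rw [Finset.sum_range_succ] at h1
    have h2 := sum_weight hα hβ m
    have h3 : (m : ℝ) ^ α ≤ ((m + 1 : ℕ) : ℝ) ^ α :=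
      Real.rpow_le_rpow hm0 (by push_cast; linarith) hα.le
    rw [hΔ, Finset.sum_sub_distrib, h2]
    nlinarith
  -- The partial sum of Δ through l is at most `weight α β m l`. By concavity of x^(α/β), (m+1)^η -
  -- (l+1)^η ≤ m^η - l^η, so advancing the time and the end point together does not enlarge the
  -- remaining mass.
  have habel : ∑ j ∈ Finset.range m, ((m : ℝ) - j) * Δ j ≤ kappa β * (m : ℝ) ^ α := by
    rw [sum_sub_mul_eq_sum_sum, ← sum_weight hα hβ m]
    refine Finset.sum_le_sum fun l hl => ?_
    have hlm : (l : ℝ) + 1 ≤ m := by exact_mod_cast Finset.mem_range.1 hl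
    have hl0 : (0 : ℝ) ≤ l := Nat.cast_nonneg l
    have h1 := Real.rpow_le_rpow hm0 (by linarith : (m : ℝ) ≤ m + 1) hα.le
    have h2 : (((m : ℝ) + 1) ^ (α / β) - ((l : ℝ) + 1) ^ (α / β)) ^ β ≤
        ((m : ℝ) ^ (α / β) - (l : ℝ) ^ (α / β)) ^ β := by
      refine Real.rpow_le_rpow ?_ ?_ hβ.le
      · exact sub_nonneg.2 (Real.rpow_le_rpow (by linarith) (by linarith) hη.le)
      · linarith [rpow_add_one_sub_rpow_antitone hη.le hη1 hl0 (by linarith : (l : ℝ) ≤ m)]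
    rw [hΔ, Finset.sum_sub_distrib, sum_weight_range, sum_weight_range, weight]
    push_cast
    rw [Real.zero_rpow hη.ne', sub_zero, sub_zero, rpow_div_rpow hβ hm0,
      rpow_div_rpow hβ (by linarith)]
    nlinarith
  -- Split m+1 = (m-j) + (j+1): the first part uses the first moment, the second turns (j+1)^(α-1)
  -- into (j+1)^α and uses the total mass.
  have hterm : ∀ j ∈ Finset.range m, ((m : ℝ) + 1) * (((j : ℝ) + 1) ^ (α - 1) * Δ j) ≤
      ((m : ℝ) - j) * Δ j + ((m : ℝ) + 1) ^ α * Δ j := by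
    intro j hj
    have hjm : (j : ℝ) + 1 ≤ m := by exact_mod_cast Finset.mem_range.1 hj
    have hj0 : (0 : ℝ) ≤ j := Nat.cast_nonneg j
    have e1 : ((j : ℝ) + 1) * ((j : ℝ) + 1) ^ (α - 1) = ((j : ℝ) + 1) ^ α := by
      rw [mul_comm, ← Real.rpow_add_one (by linarith), sub_add_cancel]
    have e2 : ((j : ℝ) + 1) ^ α ≤ ((m : ℝ) + 1) ^ α :=
      Real.rpow_le_rpow (by linarith) (by linarith) hα.le
    have e3 : ((m : ℝ) - j) * ((j : ℝ) + 1) ^ (α - 1) ≤ (m : ℝ) - j :=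
      mul_le_of_le_one_right (by linarith) (hpow j hj0)
    have e4 : ((m : ℝ) + 1) * ((j : ℝ) + 1) ^ (α - 1) ≤ ((m : ℝ) - j) + ((m : ℝ) + 1) ^ α := by
      have : ((m : ℝ) + 1) * ((j : ℝ) + 1) ^ (α - 1) =
        ((m : ℝ) - j) * ((j : ℝ) + 1) ^ (α - 1) + ((j : ℝ) + 1) * ((j : ℝ) + 1) ^ (α - 1) := by ring
      linarith
    rw [← mul_assoc, ← add_mul]
    exact mul_le_mul_of_nonneg_right e4 (hΔ0 j hj)
  have hS := Finset.sum_le_sum hterm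
  rw [← Finset.mul_sum, Finset.sum_add_distrib, ← Finset.mul_sum] at hS
  have e0 : ((m : ℝ) + 1) * ((m : ℝ) + 1) ^ (α - 1) = ((m : ℝ) + 1) ^ α := by
    rw [mul_comm, ← Real.rpow_add_one (by linarith), sub_add_cancel]
  have e1 := Real.rpow_le_rpow hm0 (by linarith : (m : ℝ) ≤ m + 1) hα.le
  have e2 : 0 < ((m : ℝ) + 1) ^ α := Real.rpow_pos_of_pos (by linarith) _
  have e3 : 0 < ((m : ℝ) + 1) ^ (α - 1) := Real.rpow_pos_of_pos (by linarith) _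
  have h4 : ((m : ℝ) + 1) * ∑ j ∈ Finset.range m, ((j : ℝ) + 1) ^ (α - 1) * Δ j ≤
      ((m : ℝ) + 1) * (2 * kappa β * ((m : ℝ) + 1) ^ (α - 1)) := by
    have : ((m : ℝ) + 1) * (2 * kappa β * ((m : ℝ) + 1) ^ (α - 1)) =
      2 * kappa β * ((m : ℝ) + 1) ^ α := by rw [← e0]; ring
    nlinarith
  have h5 := le_of_mul_le_mul_left h4 (by linarith)
  nlinarith

theorem norm_sub_le_of_holder {F : Type*} [NormedAddCommGroup F] {f : ℝ → F} {A : ℝ} (hA : 0 ≤ A) (hα : 0 < α) (hα1 : α < 1)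
    (hf : ∀ s t, 0 ≤ s → s ≤ t → ‖f t - f s‖ ≤ A * (t ^ α - s ^ α)) (j : ℕ) {s : ℝ}
    (hs : s ∈ Ioo (j : ℝ) (j + 1)) : ‖f s - f (j + 1)‖ ≤ A * ((j : ℝ) + 1) ^ (α - 1) := by
  have hj0 : (0 : ℝ) ≤ j := Nat.cast_nonneg j
  rw [norm_sub_rev]
  refine (hf s _ (hj0.trans hs.1.le) hs.2.le).trans (mul_le_mul_of_nonneg_left ?_ hA)
  have := Real.rpow_le_rpow hj0 hs.1.le hα.le
  linarith [rpow_sub_rpow_sub_one_le hα hα1.le hj0]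

/-- On cell j the Hölder bound gives |f(s) - f(j+1)| ≤ A (j+1)^(α-1), and the kernel at time m
dominates the one at m+1. The moment bound for the weight differences then controls the sum, the new
last cell included. -/
theorem norm_sum_cellError_sub_le_of_le_one (hα : 0 < α) (hα1 : α < 1) (hβ : 0 < β)
    (hβ1 : β < 1) (hη1 : α / β ≤ 1) {f : ℝ → E} (hfc : Continuous f) {A : ℝ} (hA : 0 ≤ A)
    (hf : ∀ s t, 0 ≤ s → s ≤ t → ‖f t - f s‖ ≤ A * (t ^ α - s ^ α)) (m : ℕ) :
    ‖∑ j ∈ Finset.range (m + 1), cellError α β f (m + 1) j -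
      ∑ j ∈ Finset.range m, cellError α β f m j‖ ≤ 3 * kappa β * A * ((m : ℝ) + 1) ^ (α - 1) := by
  have hcell : ∀ j ∈ Finset.range m, ‖cellError α β f (m + 1) j - cellError α β f m j‖ ≤
      A * (((j : ℝ) + 1) ^ (α - 1) * (weight α β m j - weight α β (m + 1) j)) := by
    intro j hj
    have hj := Finset.mem_range.1 hj
    have hj0 : (0 : ℝ) ≤ j := Nat.cast_nonneg j
    have hjm : (j : ℝ) + 1 ≤ m := by exact_mod_cast hj
    have i1 := intervalIntegrable_kernel (t := m) hα hβ hj0 (by linarith : (j : ℝ) ≤ j + 1) hjm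
    have i2 := intervalIntegrable_kernel (t := (m + 1 : ℕ)) hα hβ hj0
      (by linarith : (j : ℝ) ≤ j + 1) (by push_cast; linarith)
    have hc : Continuous fun s => f s - f (j + 1) := hfc.sub continuous_const
    rw [weight_eq_integral hα hβ hj, weight_eq_integral hα hβ (hj.trans m.lt_succ_self),
      ← intervalIntegral.integral_sub i1 i2, norm_sub_rev, cellError, cellError,
      ← intervalIntegral.integral_sub (i1.smul_continuousOn hc.continuousOn)
        (i2.smul_continuousOn hc.continuousOn), ← mul_assoc]
    simp_rw [← sub_smul]
    refine norm_integral_smul_le (by linarith) (i1.sub i2) (fun s hs => ?_) fun s hs =>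
      norm_sub_le_of_holder hA hα hα1 hf j hs
    exact sub_nonneg.2 (kernel_le_kernel_of_le hα hβ hβ1 (hj0.trans hs.1.le)
      (by linarith [hs.2]) (by push_cast; linarith))
  have hlast : ‖cellError α β f (m + 1) m‖ ≤
      A * (((m : ℝ) + 1) ^ (α - 1) * weight α β (m + 1) m) := by
    have hm0 : (0 : ℝ) ≤ m := Nat.cast_nonneg m
    rw [weight_eq_integral hα hβ m.lt_succ_self, ← mul_assoc, cellError]
    refine norm_integral_smul_le (by linarith)
      (intervalIntegrable_kernel hα hβ hm0 (by linarith) (by push_cast; linarith))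
      (fun s hs => ?_) fun s hs => norm_sub_le_of_holder hA hα hα1 hf m hs
    exact kernel_nonneg hα hβ (hm0.trans hs.1.le) (by push_cast; linarith [hs.2])
  rw [Finset.sum_range_succ, add_sub_right_comm, ← Finset.sum_sub_distrib]
  refine (norm_add_le _ _).trans ((add_le_add ((norm_sum_le _ _).trans
    (Finset.sum_le_sum hcell)) hlast).trans ?_)
  rw [← Finset.mul_sum, ← mul_add]
  have := sum_rpow_mul_weight_sub_le hα hα1 hβ hβ1 hη1 m
  nlinarith

theorem summable_add_one_rpow_sub_two (hα1 : α < 1) :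
    Summable fun j : ℕ => ((j : ℝ) + 1) ^ (α - 2) := by
  have := (summable_nat_add_iff 1).2 (Real.summable_nat_rpow.2 (by linarith : α - 2 < -1))
  simpa using this

/-- Cell j+1 at time m+1 is paired with cell j at time m, leaving the first cell alone. The
increment splits into a second difference of f against the new kernel and a first difference against
the increment of the kernel. The latter is nonnegative on the diagonal, and its mass is at most that
of (m+1)^α - m^α. -/
theorem norm_sum_cellError_sub_le_of_one_le (hα : 0 < α) (hα1 : α < 1) (hβ : 0 < β)
    (hβ1 : β < 1) (hη1 : 1 ≤ α / β) {f : ℝ → E} (hfc : Continuous f) {A : ℝ} (hA : 0 ≤ A)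
    (hf : ∀ s t, 0 ≤ s → s ≤ t → ‖f t - f s‖ ≤ A * (t ^ α - s ^ α)) (m : ℕ)
    (hf2 : ∀ j : ℕ, j + 1 ≤ m → ∀ s ∈ Ioo (j : ℝ) (j + 1),
      ‖(f (s + 1) - f s) - (f (j + 2) - f (j + 1))‖ ≤ A * ((j : ℝ) + 1) ^ (α - 2)) :
    ‖∑ j ∈ Finset.range (m + 1), cellError α β f (m + 1) j -
      ∑ j ∈ Finset.range m, cellError α β f m j‖ ≤
      (3 + 2 * ∑' j : ℕ, ((j : ℝ) + 1) ^ (α - 2)) * kappa β * A * ((m : ℝ) + 1) ^ (α - 1) := by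
  have hκ := kappa_pos hβ
  have hm0 : (0 : ℝ) ≤ m := Nat.cast_nonneg m
  have e0 : ((m : ℝ) + 1) * ((m : ℝ) + 1) ^ (α - 1) = ((m : ℝ) + 1) ^ α := by
    rw [mul_comm, ← Real.rpow_add_one (by linarith), sub_add_cancel]
  have e2 : 0 < ((m : ℝ) + 1) ^ α := Real.rpow_pos_of_pos (by linarith) _
  have e3 : 0 < ((m : ℝ) + 1) ^ (α - 1) := Real.rpow_pos_of_pos (by linarith) _
  have hfirst : ‖cellError α β f (m + 1) 0‖ ≤ A * (kappa β * ((m : ℝ) + 1) ^ (α - 1)) := by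
    have h1 : ‖cellError α β f (m + 1) 0‖ ≤ A * weight α β (m + 1) 0 := by
      rw [weight_eq_integral hα hβ m.succ_pos, cellError]
      refine norm_integral_smul_le (by simp)
        (intervalIntegrable_kernel hα hβ (by simp) (by simp) (by push_cast; linarith))
        (fun s hs => ?_) fun s hs => ?_
      · simp only [Nat.cast_zero, zero_add] at hs
        exact kernel_nonneg hα hβ hs.1.le (by push_cast; linarith [hs.2])
      · simpa using norm_sub_le_of_holder hA hα hα1 hf 0 hs
    have h2 := mul_weight_le hα hβ hβ1 hη1 m.succ_pos
    push_cast at h2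
    rw [sub_zero, ← e0] at h2
    have h3 : weight α β (m + 1) 0 ≤ kappa β * ((m : ℝ) + 1) ^ (α - 1) := by
      refine le_of_mul_le_mul_left (h2.trans_eq ?_) (by linarith : (0 : ℝ) < m + 1)
      ring
    exact h1.trans (mul_le_mul_of_nonneg_left h3 hA)
  have hcell : ∀ j ∈ Finset.range m, ‖cellError α β f (m + 1) (j + 1) - cellError α β f m j‖ ≤
      A * (((j : ℝ) + 1) ^ (α - 2) * weight α β (m + 1) (j + 1) +
        (weight α β (m + 1) (j + 1) - weight α β m j)) := by
    intro j hj
    have hj := Finset.mem_range.1 hj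
    have hj0 : (0 : ℝ) ≤ j := Nat.cast_nonneg j
    have hjm : (j : ℝ) + 1 ≤ m := by exact_mod_cast hj
    have i1 := intervalIntegrable_kernel (t := m) hα hβ hj0 (by linarith : (j : ℝ) ≤ j + 1) hjm
    have i2 : IntervalIntegrable (fun s => kernel α β (m + 1 : ℕ) (s + 1)) volume j (j + 1) := by
      have h := intervalIntegrable_kernel (t := (m + 1 : ℕ)) hα hβ (a := (j : ℝ) + 1)
        (b := (j : ℝ) + 1 + 1) (by positivity) (by linarith) (by push_cast; linarith)
      simpa using h.comp_add_right 1
    have hc1 : Continuous fun s => f s - f (j + 1) := hfc.sub continuous_const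
    have hc2 : Continuous fun s => (f (s + 1) - f s) - (f (j + 2) - f (j + 1)) := by fun_prop
    have w1 : weight α β (m + 1) (j + 1) =
        ∫ s in (j : ℝ)..(j + 1 : ℝ), kernel α β (m + 1 : ℕ) (s + 1) := by
      rw [weight_eq_integral hα hβ (Nat.succ_lt_succ hj)]
      push_cast
      rw [← intervalIntegral.integral_comp_add_right (fun s => kernel α β ((m : ℝ) + 1) s) 1]
    have c1 : cellError α β f (m + 1) (j + 1) = ∫ s in (j : ℝ)..(j + 1 : ℝ),
        kernel α β (m + 1 : ℕ) (s + 1) • (f (s + 1) - f (j + 2)) := by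
      unfold cellError
      push_cast
      rw [← intervalIntegral.integral_comp_add_right
        (fun s => kernel α β ((m : ℝ) + 1) s • (f s - f ((j : ℝ) + 1 + 1))) 1]
      have : (j : ℝ) + 1 + 1 = j + 2 := by ring
      rw [this]
    have split : cellError α β f (m + 1) (j + 1) - cellError α β f m j =
        (∫ s in (j : ℝ)..(j + 1 : ℝ), kernel α β (m + 1 : ℕ) (s + 1) •
          ((f (s + 1) - f s) - (f (j + 2) - f (j + 1)))) +
        ∫ s in (j : ℝ)..(j + 1 : ℝ), (kernel α β (m + 1 : ℕ) (s + 1) - kernel α β m s) •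
          (f s - f (j + 1)) := by
      have hc3 : Continuous fun s => f (s + 1) - f (j + 2) := by fun_prop
      rw [c1, cellError, ← intervalIntegral.integral_add (i2.smul_continuousOn hc2.continuousOn)
          ((i2.sub i1).smul_continuousOn hc1.continuousOn),
        ← intervalIntegral.integral_sub (i2.smul_continuousOn hc3.continuousOn)
          (i1.smul_continuousOn hc1.continuousOn)]
      refine intervalIntegral.integral_congr fun s _ => ?_
      simp only [sub_smul, smul_sub]
      abel
    rw [split, mul_add, ← mul_assoc]
    refine (norm_add_le _ _).trans (add_le_add ?_ ?_)
    · rw [w1]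
      refine norm_integral_smul_le (by linarith) i2 (fun s hs => ?_) fun s hs => hf2 j hj s hs
      exact kernel_nonneg hα hβ (by linarith [hs.1]) (by push_cast; linarith [hs.2])
    · rw [w1, weight_eq_integral hα hβ hj, ← intervalIntegral.integral_sub i2 i1]
      refine norm_integral_smul_le (by linarith) (i2.sub i1) (fun s hs => ?_) fun s hs => ?_
      · push_cast
        exact sub_nonneg.2 (kernel_le_kernel_add_one hα hβ hβ1 hη1 (hj0.trans hs.1.le)
          (by linarith [hs.2]))
      · refine (norm_sub_le_of_holder hA hα hα1 hf j hs).trans (mul_le_of_le_one_right hA ?_)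
        exact Real.rpow_le_one_of_one_le_of_nonpos (by linarith) (by linarith)
  have hW : ∑ j ∈ Finset.range m, weight α β (m + 1) (j + 1) + weight α β (m + 1) 0 =
      kappa β * ((m : ℝ) + 1) ^ α := by
    rw [← Finset.sum_range_succ', sum_weight hα hβ]
    push_cast
    rfl
  have hW0 : 0 ≤ weight α β (m + 1) 0 := weight_nonneg hα hβ m.succ_pos
  have hmono : ∑ j ∈ Finset.range m, (weight α β (m + 1) (j + 1) - weight α β m j) ≤
      kappa β * ((m : ℝ) + 1) ^ (α - 1) := by
    rw [Finset.sum_sub_distrib, sum_weight hα hβ m]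
    have := rpow_sub_rpow_sub_one_le hα hα1.le hm0
    nlinarith
  set Z := ∑' j : ℕ, ((j : ℝ) + 1) ^ (α - 2) with hZ
  have hZs : ∑ j ∈ Finset.range m, ((j : ℝ) + 1) ^ (α - 2) ≤ Z :=
    (summable_add_one_rpow_sub_two hα1).sum_le_tsum _ fun j _ => by positivity
  have hsec : ∑ j ∈ Finset.range m, ((j : ℝ) + 1) ^ (α - 2) * weight α β (m + 1) (j + 1) ≤
      (2 * Z + 1) * (kappa β * ((m : ℝ) + 1) ^ (α - 1)) := by
    -- Again m+1 = (m-j) + (j+1). The part m-j is absorbed by the weight, leaving the summable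
    -- (j+1)^(α-2); the part j+1 cancels the decay, leaving the total mass.
    have hterm : ∀ j ∈ Finset.range m,
        ((m : ℝ) + 1) * (((j : ℝ) + 1) ^ (α - 2) * weight α β (m + 1) (j + 1)) ≤
        2 * (kappa β * ((m : ℝ) + 1) ^ α) * ((j : ℝ) + 1) ^ (α - 2) +
          weight α β (m + 1) (j + 1) := by
      intro j hj
      have hj := Finset.mem_range.1 hj
      have hj0 : (0 : ℝ) ≤ j := Nat.cast_nonneg j
      have hjm : (j : ℝ) + 1 ≤ m := by exact_mod_cast hj
      have h1 := mul_weight_le hα hβ hβ1 hη1 (Nat.succ_lt_succ hj)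
      push_cast at h1
      have h2 := weight_nonneg hα hβ (Nat.succ_lt_succ hj)
      set B := weight α β (m + 1) (j + 1)
      have h3 : ((j : ℝ) + 1) * ((j : ℝ) + 1) ^ (α - 2) ≤ 1 := by
        rw [mul_comm, ← Real.rpow_add_one (by linarith)]
        exact Real.rpow_le_one_of_one_le_of_nonpos (by linarith) (by linarith)
      have h4 : 0 ≤ ((j : ℝ) + 1) ^ (α - 2) := by positivity
      have h5 : ((m : ℝ) - j) * B * ((j : ℝ) + 1) ^ (α - 2) ≤
          kappa β * ((m : ℝ) + 1) ^ α * ((j : ℝ) + 1) ^ (α - 2) :=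
        mul_le_mul_of_nonneg_right (by linarith) h4
      have h6 : ((j : ℝ) + 1) * ((j : ℝ) + 1) ^ (α - 2) * B ≤ B := mul_le_of_le_one_left h2 h3
      have h7 : 0 ≤ kappa β * ((m : ℝ) + 1) ^ α * ((j : ℝ) + 1) ^ (α - 2) := by positivity
      linarith
    have hS := Finset.sum_le_sum hterm
    rw [← Finset.mul_sum, Finset.sum_add_distrib, ← Finset.mul_sum] at hS
    refine le_of_mul_le_mul_left (hS.trans ?_) (by linarith : (0 : ℝ) < m + 1)
    have : ((m : ℝ) + 1) * ((2 * Z + 1) * (kappa β * ((m : ℝ) + 1) ^ (α - 1))) =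
      2 * (kappa β * ((m : ℝ) + 1) ^ α) * Z + kappa β * ((m : ℝ) + 1) ^ α := by rw [← e0]; ring
    rw [this]
    have h8 : 2 * (kappa β * ((m : ℝ) + 1) ^ α) * ∑ j ∈ Finset.range m, ((j : ℝ) + 1) ^ (α - 2) ≤
      2 * (kappa β * ((m : ℝ) + 1) ^ α) * Z := mul_le_mul_of_nonneg_left hZs (by positivity)
    linarith
  rw [Finset.sum_range_succ', add_sub_right_comm, ← Finset.sum_sub_distrib]
  refine (norm_add_le _ _).trans ((add_le_add ((norm_sum_le _ _).trans
    (Finset.sum_le_sum hcell)) hfirst).trans ?_)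
  rw [← Finset.mul_sum, Finset.sum_add_distrib, ← mul_add]
  have : (3 + 2 * Z) * kappa β * A * ((m : ℝ) + 1) ^ (α - 1) =
    A * ((2 * Z + 1) * (kappa β * ((m : ℝ) + 1) ^ (α - 1)) +
      kappa β * ((m : ℝ) + 1) ^ (α - 1) + kappa β * ((m : ℝ) + 1) ^ (α - 1)) := by ring
  rw [this]
  exact mul_le_mul_of_nonneg_left (by linarith) hA

end Quadrature

end ErdelyiKober

namespace ErdelyiKober

/-! ### Consistency of the discrete operator on the unit grid. -/

section Consistency

variable {E : Type*} [NormedAddCommGroup E] [NormedSpace ℝ E] {α β : ℝ}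

/-- The discretization of `d/dt (t^α I_{α/β}^{0,β})` at `t = m + 1` for the step size `1`, where
`φ j` is the value at `j + 1`. -/
noncomputable def discreteOp (α β : ℝ) (φ : ℕ → E) (m : ℕ) : E :=
  (1 + α / ((m : ℝ) + 1)) • weightedSum α β φ (m + 1) -
    (((m : ℝ) + 1) / m) ^ α • weightedSum α β φ m

/-- The consistency error of `discreteOp` for the constant function with value `1 / κ`. -/
noncomputable def constDefect (α : ℝ) (m : ℕ) : ℝ :=
  ((m : ℝ) + 1) ^ α - (m : ℝ) ^ α -
    ((1 + α / ((m : ℝ) + 1)) * ((m : ℝ) + 1) ^ α - (((m : ℝ) + 1) / m) ^ α * (m : ℝ) ^ α)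

theorem div_rpow_le_one_add_div (hα : 0 < α) (hα1 : α < 1) {x : ℝ} (hx : 0 < x) :
    ((x + 1) / x) ^ α ≤ 1 + α / x := by
  have h := rpow_one_add_le_one_add_mul_self (s := 1 / x)
    (by have := one_div_pos.2 hx; linarith) hα.le hα1.le
  have e : (x + 1) / x = 1 + 1 / x := by field_simp
  rw [e, div_eq_mul_one_div α x]
  exact h

theorem div_add_one_rpow_le (hα : 0 < α) (hα1 : α < 1) {x : ℝ} (hx : 0 < x) :
    (x / (x + 1)) ^ α ≤ 1 - α / (x + 1) := by
  have h1 : 1 / (x + 1) ≤ 1 := by rw [div_le_one (by linarith)]; linarith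
  have h := rpow_one_add_le_one_add_mul_self (s := -(1 / (x + 1))) (by linarith) hα.le hα1.le
  have e : x / (x + 1) = 1 + -(1 / (x + 1)) := by field_simp; ring
  rw [e]
  refine h.trans (le_of_eq ?_)
  ring

/-- Bernoulli's inequality for x/(x+1) = 1 - 1/(x+1), inverted through 1 + a ≤ 1/(1-a). It makes the
past coefficients of `discreteOp` have one sign. -/
theorem one_add_div_le_div_rpow (hα : 0 < α) (hα1 : α < 1) {x : ℝ} (hx : 0 < x) :
    1 + α / (x + 1) ≤ ((x + 1) / x) ^ α := by
  have h := div_add_one_rpow_le hα hα1 hx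
  have e : ((x + 1) / x) ^ α = ((x / (x + 1)) ^ α)⁻¹ := by
    rw [← Real.inv_rpow (by positivity), inv_div]
  have hpos : 0 < (x / (x + 1)) ^ α := Real.rpow_pos_of_pos (by positivity) _
  have ha : 0 < α / (x + 1) := by positivity
  rw [e, le_inv_comm₀ (by linarith) hpos]
  refine h.trans ?_
  rw [le_inv_comm₀ (by linarith) (by linarith), le_inv_comm₀ (by linarith) (by linarith),
    ← one_div, le_div_iff₀ (by linarith)]
  nlinarith [sq_nonneg (α / (x + 1))]

theorem div_rpow_mul_rpow {x : ℝ} (hx : 0 < x) : ((x + 1) / x) ^ α * x ^ α = (x + 1) ^ α := by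
  rw [← Real.mul_rpow (by positivity) hx.le, div_mul_cancel₀ _ hx.ne']

theorem div_rpow_mul_rpow_le (hα : 0 < α) {x : ℝ} (hx : 0 ≤ x) :
    ((x + 1) / x) ^ α * x ^ α ≤ (x + 1) ^ α := by
  rcases hx.eq_or_lt with rfl | hx
  · simp [Real.zero_rpow hα.ne']
  · exact (div_rpow_mul_rpow hx).le

/-- For m ≥ 1 the defect lies between 0 and α (m^(α-1) - (m+1)^(α-1)) by concavity, so these terms
telescope to at most α. The term m = 0 contributes another α. -/
theorem sum_abs_constDefect_le (hα : 0 < α) (hα1 : α < 1) (N : ℕ) :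
    ∑ m ∈ Finset.range N, |constDefect α m| ≤ 2 * α := by
  have key : ∀ N : ℕ, ∑ m ∈ Finset.range (N + 1), |constDefect α m| ≤
      2 * α - α * ((N : ℝ) + 1) ^ (α - 1) := by
    intro N
    induction N with
    | zero =>
      -- The quotient by m = 0 is harmless here, since it multiplies 0^α = 0.
      have : constDefect α 0 = -α := by
        simp [constDefect, Real.zero_rpow hα.ne']
      rw [Finset.sum_range_one, this, abs_neg, abs_of_pos hα]
      simp
      linarith
    | succ N ih =>
      rw [Finset.sum_range_succ]
      set x : ℝ := (N : ℝ) + 1 with hx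
      have hx0 : 0 < x := by positivity
      have hcast : ((N + 1 : ℕ) : ℝ) = x := by push_cast; rfl
      have e : constDefect α (N + 1) = (x + 1) ^ α - x ^ α - α * (x + 1) ^ (α - 1) := by
        rw [constDefect, hcast, div_rpow_mul_rpow hx0, Real.rpow_sub_one (by linarith)]
        field_simp
        ring
      have e1 : x ^ α ≤ (x + 1) ^ α - α * (x + 1) ^ (α - 1) := by
        have h := div_add_one_rpow_le hα hα1 hx0
        rw [Real.div_rpow hx0.le (by linarith),
          div_le_iff₀ (Real.rpow_pos_of_pos (by linarith) _)] at h
        rw [Real.rpow_sub_one (by linarith)]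
        refine h.trans (le_of_eq ?_)
        ring
      have e2 : (x + 1) ^ α ≤ x ^ α + α * x ^ (α - 1) := by
        have h := div_rpow_le_one_add_div hα hα1 hx0
        rw [Real.div_rpow (by linarith) hx0.le,
          div_le_iff₀ (Real.rpow_pos_of_pos hx0 _)] at h
        rw [Real.rpow_sub_one hx0.ne']
        refine h.trans (le_of_eq ?_)
        ring
      rw [hcast, e, abs_of_nonneg (by linarith)]
      linarith
  rcases N with _ | N
  · simp [hα.le]
  · refine (key N).trans ?_
    have : 0 ≤ α * ((N : ℝ) + 1) ^ (α - 1) := by positivity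
    linarith

theorem kernelIntegral_mul (hα : 0 < α) (hβ : 0 < β) (f : ℝ → E) {k t : ℝ} (hk : 0 < k)
    (ht : 0 ≤ t) :
    kernelIntegral α β f (k * t) = k ^ α • kernelIntegral α β (fun s => f (k * s)) t := by
  have h : k • ∫ s in (0 : ℝ)..t, kernel α β (k * t) (k * s) • f (k * s) =
      ∫ s in k * 0..k * t, kernel α β (k * t) s • f s :=
    intervalIntegral.smul_integral_comp_mul_left (fun s => kernel α β (k * t) s • f s) k
  rw [mul_zero] at h
  rw [kernelIntegral, ← h, kernelIntegral]
  have e : k ^ α = k * k ^ (α - 1) := by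
    rw [mul_comm, ← Real.rpow_add_one hk.ne', sub_add_cancel]
  have hc : ∫ s in (0 : ℝ)..t, kernel α β (k * t) (k * s) • f (k * s) =
      ∫ s in (0 : ℝ)..t, k ^ (α - 1) • (kernel α β t s • f (k * s)) := by
    refine intervalIntegral.integral_congr fun s hs => ?_
    rw [uIcc_of_le ht] at hs
    rw [kernel_mul hα hβ hk hs.1 hs.2, mul_smul]
  rw [e, mul_smul, hc, intervalIntegral.integral_smul]

theorem norm_kernelIntegral_le (hα : 0 < α) (hβ : 0 < β) {f : ℝ → E} {t M : ℝ} (ht : 0 ≤ t)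
    (hM : ∀ s, 0 ≤ s → s ≤ t → ‖f s‖ ≤ M) :
    ‖kernelIntegral α β f t‖ ≤ M * (kappa β * t ^ α) := by
  rw [← integral_kernel_full hα hβ ht]
  exact norm_integral_smul_le ht (intervalIntegrable_kernel hα hβ le_rfl ht le_rfl)
    (fun s hs => kernel_nonneg hα hβ hs.1.le hs.2.le) fun s hs => hM s hs.1.le hs.2.le

/-- Writing J(t) = t^α J_1 with the integral J_1 over the fixed interval [0, 1] of f(t·), the
increment falls on the factor t^α or on f; no difference of singular kernels appears. -/
theorem norm_kernelIntegral_sub_le (hα : 0 < α) (hβ : 0 < β) {f : ℝ → E} (hfc : Continuous f)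
    {A M r t : ℝ} (hA : 0 ≤ A)
    (hf : ∀ s t, 0 ≤ s → s ≤ t → ‖f t - f s‖ ≤ A * (t ^ α - s ^ α))
    (hr : 0 ≤ r) (hrt : r ≤ t) (hM : ∀ s, 0 ≤ s → s ≤ t → ‖f s‖ ≤ M) :
    ‖kernelIntegral α β f t - kernelIntegral α β f r‖ ≤
      kappa β * (A * t ^ α + M) * (t ^ α - r ^ α) := by
  have hκ := kappa_pos hβ
  have ht : 0 ≤ t := hr.trans hrt
  have hM0 : 0 ≤ M := (norm_nonneg _).trans (hM 0 le_rfl ht)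
  have htα : 0 ≤ t ^ α := Real.rpow_nonneg ht _
  rcases hr.eq_or_lt with rfl | hr0
  · have h0 : kernelIntegral α β f 0 = 0 := by simp [kernelIntegral]
    rw [h0, sub_zero, Real.zero_rpow hα.ne', sub_zero]
    refine (norm_kernelIntegral_le hα hβ ht hM).trans ?_
    have : 0 ≤ kappa β * (A * t ^ α) * t ^ α := by positivity
    nlinarith
  have ht0 : 0 < t := hr0.trans_le hrt
  have hd : 0 ≤ t ^ α - r ^ α := sub_nonneg.2 (Real.rpow_le_rpow hr hrt hα.le)
  have et := kernelIntegral_mul hα hβ f ht0 zero_le_one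
  have er := kernelIntegral_mul hα hβ f hr0 zero_le_one
  rw [mul_one] at et er
  have hsub : kernelIntegral α β (fun s => f (t * s)) 1 - kernelIntegral α β (fun s => f (r * s)) 1 =
      kernelIntegral α β (fun s => f (t * s) - f (r * s)) 1 := by
    unfold kernelIntegral
    rw [← intervalIntegral.integral_sub]
    · simp_rw [smul_sub]
    · exact intervalIntegrable_kernel_smul hα hβ le_rfl zero_le_one le_rfl (by fun_prop)
    · exact intervalIntegrable_kernel_smul hα hβ le_rfl zero_le_one le_rfl (by fun_prop)
  have h1 : ‖kernelIntegral α β (fun s => f (t * s) - f (r * s)) 1‖ ≤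
      A * (t ^ α - r ^ α) * (kappa β * 1 ^ α) := by
    refine norm_kernelIntegral_le hα hβ zero_le_one fun s hs hs1 => ?_
    refine (hf _ _ (mul_nonneg hr hs) (mul_le_mul_of_nonneg_right hrt hs)).trans ?_
    rw [Real.mul_rpow ht hs, Real.mul_rpow hr hs, ← sub_mul]
    exact mul_le_mul_of_nonneg_left
      (mul_le_of_le_one_right hd (Real.rpow_le_one hs hs1 hα.le)) hA
  have h2 : ‖kernelIntegral α β (fun s => f (r * s)) 1‖ ≤ M * (kappa β * 1 ^ α) :=
    norm_kernelIntegral_le hα hβ zero_le_one fun s hs hs1 =>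
      hM _ (mul_nonneg hr hs) ((mul_le_of_le_one_right hr hs1).trans hrt)
  rw [Real.one_rpow, mul_one] at h1 h2
  have hsplit : kernelIntegral α β f t - kernelIntegral α β f r =
      t ^ α • kernelIntegral α β (fun s => f (t * s) - f (r * s)) 1 +
        (t ^ α - r ^ α) • kernelIntegral α β (fun s => f (r * s)) 1 := by
    rw [et, er, ← hsub, smul_sub, sub_smul]
    abel
  rw [hsplit]
  refine (norm_add_le _ _).trans ?_
  rw [norm_smul, norm_smul, Real.norm_of_nonneg htα, Real.norm_of_nonneg hd]
  have h3 := mul_le_mul_of_nonneg_left h1 htα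
  have h4 := mul_le_mul_of_nonneg_left h2 hd
  nlinarith

theorem weightedSum_const (hα : 0 < α) (hβ : 0 < β) (c : E) (n : ℕ) :
    weightedSum α β (fun _ => c) n = (kappa β * (n : ℝ) ^ α) • c := by
  rw [weightedSum, ← Finset.sum_smul, sum_weight hα hβ]

theorem weightedSum_sub (φ ψ : ℕ → E) (n : ℕ) :
    weightedSum α β (fun j => φ j - ψ j) n = weightedSum α β φ n - weightedSum α β ψ n := by
  simp only [weightedSum, smul_sub, Finset.sum_sub_distrib]

theorem discreteOp_sub (φ ψ : ℕ → E) (m : ℕ) :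
    discreteOp α β (fun j => φ j - ψ j) m = discreteOp α β φ m - discreteOp α β ψ m := by
  simp only [discreteOp, weightedSum_sub, smul_sub]
  abel

theorem norm_weightedSum_le (hα : 0 < α) (hβ : 0 < β) {φ : ℕ → E} {n : ℕ} {M : ℝ}
    (hM : ∀ j, j < n → ‖φ j‖ ≤ M) : ‖weightedSum α β φ n‖ ≤ M * (kappa β * (n : ℝ) ^ α) := by
  rw [← sum_weight hα hβ, Finset.mul_sum]
  refine (norm_sum_le _ _).trans (Finset.sum_le_sum fun j hj => ?_)
  have hj := Finset.mem_range.1 hj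
  rw [norm_smul, Real.norm_of_nonneg (weight_nonneg hα hβ hj), mul_comm]
  exact mul_le_mul_of_nonneg_right (hM j hj) (weight_nonneg hα hβ hj)

/-- The constant in the consistency estimate. -/
noncomputable def consistencyConst (α β : ℝ) : ℝ :=
  2 * ((3 + 2 * ∑' j : ℕ, ((j : ℝ) + 1) ^ (α - 2)) * kappa β) + 4 * kappa β

/-- With plain differences in place of the coefficients 1 + α/(m+1) and ((m+1)/m)^α, the error is
the increment of the quadrature error. The coefficients exceed 1 by nearly the same amount, so
changing them costs α/(m+1) times an increment of J and a gap of order (m+1)^(-2) times a sum. As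
f(0) = 0, f is at most A (m+1)^α in size on [0, m+1], and both costs fit. -/
theorem norm_kernelIntegral_sub_sub_discreteOp_le_of_zero [CompleteSpace E] (hα : 0 < α)
    (hα1 : α < 1) (hβ : 0 < β) (hβ1 : β < 1) {f : ℝ → E} (hfc : Continuous f) {A : ℝ}
    (hA : 0 ≤ A) (hf0 : f 0 = 0)
    (hf : ∀ s t, 0 ≤ s → s ≤ t → ‖f t - f s‖ ≤ A * (t ^ α - s ^ α)) (m : ℕ)
    (hf2 : ∀ j : ℕ, j + 1 ≤ m → ∀ s ∈ Ioo (j : ℝ) (j + 1),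
      ‖(f (s + 1) - f s) - (f (j + 2) - f (j + 1))‖ ≤ A * ((j : ℝ) + 1) ^ (α - 2)) :
    ‖kernelIntegral α β f (m + 1) - kernelIntegral α β f m -
      discreteOp α β (fun j => f (j + 1)) m‖ ≤
      consistencyConst α β * A * ((m : ℝ) + 1) ^ (α - 1) := by
  have hκ := kappa_pos hβ
  have hm0 : (0 : ℝ) ≤ m := Nat.cast_nonneg m
  set X := ((m : ℝ) + 1) ^ (α - 1) with hX
  have hX0 : 0 < X := Real.rpow_pos_of_pos (by linarith) _
  have hX1 : X ≤ 1 := Real.rpow_le_one_of_one_le_of_nonpos (by linarith) (by linarith)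
  have eX : ((m : ℝ) + 1) * X = ((m : ℝ) + 1) ^ α := by
    rw [hX, mul_comm, ← Real.rpow_add_one (by linarith), sub_add_cancel]
  set Z := ∑' j : ℕ, ((j : ℝ) + 1) ^ (α - 2) with hZ
  have hZ0 : 0 ≤ Z := tsum_nonneg fun j => by positivity
  set c := (3 + 2 * Z) * kappa β with hc
  have hc0 : 0 ≤ c := by positivity
  set S := weightedSum α β fun j : ℕ => f (j + 1) with hS
  set J := kernelIntegral α β f with hJ
  have eP1 := kernelIntegral_sub_weightedSum hα hβ hfc (m + 1)
  have eP0 := kernelIntegral_sub_weightedSum hα hβ hfc m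
  push_cast at eP1
  have hP : ‖(J (m + 1) - S (m + 1)) - (J m - S m)‖ ≤ c * A * X := by
    rw [hJ, hS, eP1, eP0]
    rcases le_total (α / β) 1 with h | h
    · refine (norm_sum_cellError_sub_le_of_le_one hα hα1 hβ hβ1 h hfc hA hf m).trans ?_
      rw [hc]
      have : 0 ≤ 2 * Z * kappa β * A * X := by positivity
      linarith
    · exact norm_sum_cellError_sub_le_of_one_le hα hα1 hβ hβ1 h hfc hA hf m hf2
  set P := (J (m + 1) - S (m + 1)) - (J m - S m) with hPdef
  have hbd : ∀ s T, 0 ≤ s → s ≤ T → ‖f s‖ ≤ A * T ^ α := by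
    intro s T hs hsT
    have := hf 0 s le_rfl hs
    rw [hf0, sub_zero, Real.zero_rpow hα.ne', sub_zero] at this
    exact this.trans (mul_le_mul_of_nonneg_left (Real.rpow_le_rpow hs hsT hα.le) hA)
  have hdiscr : discreteOp α β (fun j => f (j + 1)) m =
      (1 + α / ((m : ℝ) + 1)) • S (m + 1) - (((m : ℝ) + 1) / m) ^ α • S m := rfl
  have hconst : consistencyConst α β * A * X = 2 * (c * A * X) + 4 * (kappa β * A * X) := by
    rw [consistencyConst, hc, hZ]; ring
  have hcAX : 0 ≤ c * A * X := by positivity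
  have hκAX : 0 ≤ kappa β * A * X := by positivity
  rw [hdiscr, hconst]
  rcases Nat.eq_zero_or_pos m with hm | hm
  · have hS0 : S m = 0 := by rw [hS, hm]; simp [weightedSum]
    have hS1 : ‖S (m + 1)‖ ≤ kappa β * A * X := by
      have h := norm_weightedSum_le (α := α) (φ := fun j : ℕ => f (j + 1)) (n := m + 1)
        (M := A) hα hβ (fun j hj => by
          have hj0 : j = 0 := by omega
          have := hbd 1 1 zero_le_one le_rfl
          simpa [hj0] using this)
      rw [hX, hm]
      rw [hm] at h
      refine h.trans (le_of_eq ?_)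
      simp
      ring
    have e : J (m + 1) - J m - ((1 + α / ((m : ℝ) + 1)) • S (m + 1) -
        (((m : ℝ) + 1) / m) ^ α • S m) = P - α • S (m + 1) := by
      rw [hPdef, hS0, add_smul, one_smul, hm]
      simp
      abel
    rw [e]
    refine (norm_sub_le _ _).trans ?_
    rw [norm_smul, Real.norm_of_nonneg hα.le]
    nlinarith
  · have hm1 : (1 : ℝ) ≤ m := by exact_mod_cast hm
    set ρ := (((m : ℝ) + 1) / m) ^ α with hρ
    set a := α / ((m : ℝ) + 1) with ha
    have ha0 : 0 ≤ a := by positivity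
    have ha1 : a ≤ 1 := by rw [ha, div_le_one (by linarith)]; linarith
    have hJd : ‖J (m + 1) - J m‖ ≤ 2 * kappa β * A * ((m : ℝ) + 1) ^ α * X := by
      have h := norm_kernelIntegral_sub_le hα hβ hfc (M := A * ((m : ℝ) + 1) ^ α) hA hf hm0
        (by linarith : (m : ℝ) ≤ m + 1) (fun s hs hst => hbd s _ hs hst)
      have h2 := rpow_sub_rpow_sub_one_le hα hα1.le hm0
      refine h.trans ?_
      have : 0 ≤ kappa β * (A * ((m : ℝ) + 1) ^ α + A * ((m : ℝ) + 1) ^ α) := by positivity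
      refine (mul_le_mul_of_nonneg_left h2 this).trans (le_of_eq ?_)
      ring
    have hSm : ‖S m‖ ≤ A * (m : ℝ) ^ α * (kappa β * (m : ℝ) ^ α) :=
      norm_weightedSum_le hα hβ fun j hj => hbd _ _ (by positivity) (by exact_mod_cast hj)
    have hρ1 : ρ - 1 ≤ α / m := by
      have := div_rpow_le_one_add_div hα hα1 (by linarith : (0 : ℝ) < m)
      linarith
    have hρ2 : a ≤ ρ - 1 := by
      have := one_add_div_le_div_rpow hα hα1 (by linarith : (0 : ℝ) < m)
      linarith
    -- The difference is α/(m(m+1)), and m+1 ≤ 2m.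
    have hgap : α / m - a ≤ 2 / ((m : ℝ) + 1) ^ 2 := by
      rw [ha, div_sub_div _ _ (by linarith) (by linarith), div_le_div_iff₀ (by positivity)
        (by positivity)]
      nlinarith [mul_nonneg hm0 hm0]
    have e : J (m + 1) - J m - ((1 + a) • S (m + 1) - ρ • S m) =
        (1 + a) • P - a • (J (m + 1) - J m) + ((ρ - 1) - a) • S m := by
      rw [hPdef]
      module
    have t1 : ‖(1 + a) • P‖ ≤ 2 * (c * A * X) := by
      rw [norm_smul, Real.norm_of_nonneg (by linarith)]
      nlinarith [norm_nonneg P]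
    have t2 : ‖a • (J (m + 1) - J m)‖ ≤ 2 * (kappa β * A * X) := by
      rw [norm_smul, Real.norm_of_nonneg ha0]
      refine (mul_le_mul_of_nonneg_left hJd ha0).trans ?_
      have : a * (2 * kappa β * A * ((m : ℝ) + 1) ^ α * X) = 2 * (kappa β * A * X) * (α * X) := by
        rw [← eX, ha]; field_simp
      rw [this]
      refine mul_le_of_le_one_right (by linarith) ?_
      nlinarith
    have t3 : ‖((ρ - 1) - a) • S m‖ ≤ 2 * (kappa β * A * X) := by
      rw [norm_smul, Real.norm_of_nonneg (by linarith)]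
      have hmα : (m : ℝ) ^ α ≤ ((m : ℝ) + 1) ^ α := Real.rpow_le_rpow hm0 (by linarith) hα.le
      have hmα0 : 0 ≤ (m : ℝ) ^ α := Real.rpow_nonneg hm0 _
      have h1 : ‖S m‖ ≤ kappa β * A * (((m : ℝ) + 1) ^ 2 * X * X) := by
        refine hSm.trans ?_
        have : ((m : ℝ) + 1) ^ 2 * X * X = ((m : ℝ) + 1) ^ α * ((m : ℝ) + 1) ^ α := by
          rw [← eX]; ring
        rw [this]
        have h2 : (m : ℝ) ^ α * (m : ℝ) ^ α ≤ ((m : ℝ) + 1) ^ α * ((m : ℝ) + 1) ^ α :=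
          mul_le_mul hmα hmα hmα0 (hmα0.trans hmα)
        have h3 := mul_le_mul_of_nonneg_left h2 (by positivity : 0 ≤ kappa β * A)
        linarith
      have h2 : (ρ - 1) - a ≤ 2 / ((m : ℝ) + 1) ^ 2 := by linarith
      refine (mul_le_mul h2 h1 (norm_nonneg _) (by positivity)).trans ?_
      have : 2 / ((m : ℝ) + 1) ^ 2 * (kappa β * A * (((m : ℝ) + 1) ^ 2 * X * X)) =
        2 * (kappa β * A * X) * X := by field_simp
      rw [this]
      exact mul_le_of_le_one_right (by linarith) hX1
    rw [e]
    refine (norm_add_le _ _).trans ?_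
    have := norm_sub_le ((1 + a) • P) (a • (J (m + 1) - J m))
    linarith

/-- Consistency of the discretization on the unit grid. -/
theorem norm_kernelIntegral_sub_sub_discreteOp_le [CompleteSpace E] (hα : 0 < α)
    (hα1 : α < 1) (hβ : 0 < β) (hβ1 : β < 1) {f : ℝ → E} (hfc : Continuous f) {A : ℝ}
    (hA : 0 ≤ A)
    (hf : ∀ s t, 0 ≤ s → s ≤ t → ‖f t - f s‖ ≤ A * (t ^ α - s ^ α)) (m : ℕ)
    (hf2 : ∀ j : ℕ, j + 1 ≤ m → ∀ s ∈ Ioo (j : ℝ) (j + 1),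
      ‖(f (s + 1) - f s) - (f (j + 2) - f (j + 1))‖ ≤ A * ((j : ℝ) + 1) ^ (α - 2)) :
    ‖kernelIntegral α β f (m + 1) - kernelIntegral α β f m -
      discreteOp α β (fun j => f (j + 1)) m - (kappa β * constDefect α m) • f 0‖ ≤
      consistencyConst α β * A * ((m : ℝ) + 1) ^ (α - 1) := by
  have hm0 : (0 : ℝ) ≤ m := Nat.cast_nonneg m
  -- Differences of f do not see the constant f(0), whose error is computed exactly and is the
  -- defect term.
  have h := norm_kernelIntegral_sub_sub_discreteOp_le_of_zero hα hα1 hβ hβ1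
    (f := fun s => f s - f 0) (by fun_prop) hA (sub_self _) (by simpa using hf) m
    (by simpa using hf2)
  have hJ : ∀ t : ℝ, 0 ≤ t → kernelIntegral α β (fun s => f s - f 0) t =
      kernelIntegral α β f t - (kappa β * t ^ α) • f 0 := by
    intro t ht
    rw [kernelIntegral, kernelIntegral, ← integral_kernel_full hα hβ ht,
      ← intervalIntegral.integral_smul_const, ← intervalIntegral.integral_sub]
    · simp_rw [smul_sub]
    · exact intervalIntegrable_kernel_smul hα hβ le_rfl ht le_rfl hfc
    · exact intervalIntegrable_kernel_smul hα hβ le_rfl ht le_rfl continuous_const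
  rw [hJ _ (by linarith), hJ _ hm0, discreteOp_sub (fun j : ℕ => f (j + 1)) (fun _ => f 0)] at h
  convert h using 2
  simp only [discreteOp, weightedSum_const hα hβ, constDefect]
  push_cast
  module

end Consistency

/-! ### Coercivity of the discrete operator. -/

section Energy

variable {H : Type*} [NormedAddCommGroup H] [InnerProductSpace ℝ H] {α β : ℝ}

/-- In `discreteOp` the newest value has a positive coefficient p and each past value a coefficient
-q_j ≤ 0. Young's inequality splits every cross term equally. The row surplus p - Σ q_j gives the
coercive term; the column inequality pays for the past with the decrease of the energy ½ Σ (1 + α/N)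
w_(N,j) ‖y_j‖², which telescopes in N. -/
theorem inner_discreteOp_ge (hα : 0 < α) (hα1 : α < 1) (hβ : 0 < β) (hβ1 : β < 1) (y : ℕ → H)
    (N : ℕ) :
    1 / 2 * (α * kappa β * ((N : ℝ) + 1) ^ (α - 1)) * ‖y N‖ ^ 2 +
      1 / 2 * ∑ j ∈ Finset.range (N + 1),
        (1 + α / ((N + 1 : ℕ) : ℝ)) * weight α β (N + 1) j * ‖y j‖ ^ 2 -
      1 / 2 * ∑ j ∈ Finset.range N, (1 + α / (N : ℝ)) * weight α β N j * ‖y j‖ ^ 2 ≤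
      inner ℝ (discreteOp α β y N) (y N) := by
  have hκ := kappa_pos hβ
  have hN0 : (0 : ℝ) ≤ N := Nat.cast_nonneg N
  set a := 1 + α / ((N : ℝ) + 1) with ha
  set ρ := (((N : ℝ) + 1) / N) ^ α with hρ
  set p := a * weight α β (N + 1) N with hp
  set q : ℕ → ℝ := fun j => ρ * weight α β N j - a * weight α β (N + 1) j with hq
  have hq0 : ∀ j ∈ Finset.range N, 0 ≤ q j := by
    intro j hj
    have hj := Finset.mem_range.1 hj
    have hN : (0 : ℝ) < N := by exact_mod_cast (Nat.zero_le j).trans_lt hj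
    have h1 := one_add_div_le_div_rpow hα hα1 hN
    have h2 := weight_succ_le hα hβ hβ1 hj
    have h3 := weight_nonneg hα hβ (hj.trans N.lt_succ_self)
    exact sub_nonneg.2 (mul_le_mul h1 h2 h3 (Real.rpow_nonneg (by positivity) _))
  have hinner : inner ℝ (discreteOp α β y N) (y N) =
      p * ‖y N‖ ^ 2 - ∑ j ∈ Finset.range N, q j * inner ℝ (y j) (y N) := by
    simp only [discreteOp, weightedSum, inner_sub_left, inner_smul_left, sum_inner,
      Finset.sum_range_succ, inner_add_left, real_inner_self_eq_norm_sq, hq, sub_mul,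
      Finset.sum_sub_distrib, conj_trivial, mul_add, Finset.mul_sum, hp]
    simp only [mul_assoc]
    ring
  have hcs : ∑ j ∈ Finset.range N, q j * inner ℝ (y j) (y N) ≤
      1 / 2 * (∑ j ∈ Finset.range N, q j * ‖y j‖ ^ 2 + (∑ j ∈ Finset.range N, q j) * ‖y N‖ ^ 2) := by
    rw [Finset.sum_mul, ← Finset.sum_add_distrib, Finset.mul_sum]
    refine Finset.sum_le_sum fun j hj => ?_
    have h1 := real_inner_le_norm (y j) (y N)
    have h2 : inner ℝ (y j) (y N) ≤ 1 / 2 * (‖y j‖ ^ 2 + ‖y N‖ ^ 2) := by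
      nlinarith [sq_nonneg (‖y j‖ - ‖y N‖)]
    have h3 := mul_le_mul_of_nonneg_left h2 (hq0 j hj)
    linarith
  have hrow : α * kappa β * ((N : ℝ) + 1) ^ (α - 1) ≤ p - ∑ j ∈ Finset.range N, q j := by
    have h1 := sum_weight hα hβ (N + 1)
    have h2 := sum_weight hα hβ N
    rw [Finset.sum_range_succ] at h1
    push_cast at h1
    have h3 := div_rpow_mul_rpow_le hα hN0
    have e : p - ∑ j ∈ Finset.range N, q j =
        a * (kappa β * ((N : ℝ) + 1) ^ α) - kappa β * (ρ * (N : ℝ) ^ α) := by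
      rw [hq, Finset.sum_sub_distrib, ← Finset.mul_sum, ← Finset.mul_sum, h2, ← h1, hp]
      ring
    have e2 : α * kappa β * ((N : ℝ) + 1) ^ (α - 1) =
        a * (kappa β * ((N : ℝ) + 1) ^ α) - kappa β * ((N : ℝ) + 1) ^ α := by
      rw [ha, Real.rpow_sub_one (by linarith)]
      ring
    rw [e, e2]
    have := mul_le_mul_of_nonneg_left h3 hκ.le
    linarith
  have hcol : ∑ j ∈ Finset.range N, a * weight α β (N + 1) j * ‖y j‖ ^ 2 +
      ∑ j ∈ Finset.range N, q j * ‖y j‖ ^ 2 ≤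
      ∑ j ∈ Finset.range N, (1 + α / (N : ℝ)) * weight α β N j * ‖y j‖ ^ 2 := by
    rw [← Finset.sum_add_distrib]
    refine Finset.sum_le_sum fun j hj => ?_
    have hj := Finset.mem_range.1 hj
    have hN : (0 : ℝ) < N := by exact_mod_cast (Nat.zero_le j).trans_lt hj
    have h1 := mul_le_mul_of_nonneg_right (div_rpow_le_one_add_div hα hα1 hN)
      (weight_nonneg hα hβ hj)
    rw [← add_mul, hq]
    refine mul_le_mul_of_nonneg_right ?_ (sq_nonneg _)
    simp only
    linarith
  have h5 := mul_le_mul_of_nonneg_right hrow (sq_nonneg ‖y N‖)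
  rw [hinner, Finset.sum_range_succ]
  push_cast
  rw [← ha, ← hp]
  linarith

/-- Coercivity of the discrete operator. -/
theorem sum_inner_discreteOp_ge (hα : 0 < α) (hα1 : α < 1) (hβ : 0 < β) (hβ1 : β < 1)
    (y : ℕ → H) (N : ℕ) :
    ∑ m ∈ Finset.range N, 1 / 2 * (α * kappa β * ((m : ℝ) + 1) ^ (α - 1)) * ‖y m‖ ^ 2 ≤
      ∑ m ∈ Finset.range N, inner ℝ (discreteOp α β y m) (y m) := by
  have key : ∑ m ∈ Finset.range N, 1 / 2 * (α * kappa β * ((m : ℝ) + 1) ^ (α - 1)) * ‖y m‖ ^ 2 +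
      1 / 2 * ∑ j ∈ Finset.range N, (1 + α / (N : ℝ)) * weight α β N j * ‖y j‖ ^ 2 ≤
      ∑ m ∈ Finset.range N, inner ℝ (discreteOp α β y m) (y m) := by
    induction N with
    | zero => simp
    | succ N ih =>
      have := inner_discreteOp_ge hα hα1 hβ hβ1 y N
      rw [Finset.sum_range_succ, Finset.sum_range_succ (fun m =>
        inner ℝ (discreteOp α β y m) (y m))]
      linarith
  refine le_trans (le_add_of_nonneg_right ?_) key
  refine mul_nonneg (by norm_num) (Finset.sum_nonneg fun j hj => ?_)
  have := weight_nonneg hα hβ (Finset.mem_range.1 hj)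
  positivity

end Energy

end ErdelyiKober

namespace ErdelyiKober

/-! ### Moduli of continuity from the bounds on the time derivatives. -/

section TimeRegularity

open Filter Topology

variable {E : Type*} [NormedAddCommGroup E] [NormedSpace ℝ E] {α T C : ℝ}

theorem integrable_indicator_of_norm_le {F : Type*} [NormedAddCommGroup F] {w : ℝ → F} (hα : 0 < α)
    (hT : 0 < T) (hw : LocallyIntegrableOn w (Ioo 0 T))
    (hC : ∀ᵐ t ∂(volume.restrict (Ioo 0 T)), ‖w t‖ ≤ C * t ^ (α - 1)) :
    Integrable ((Ioo 0 T).indicator w) := by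
  rw [integrable_indicator_iff measurableSet_Ioo]
  have h1 : IntegrableOn (fun t : ℝ => C * t ^ (α - 1)) (Ioo 0 T) := by
    have := (intervalIntegral.intervalIntegrable_rpow' (a := 0) (b := T)
      (by linarith : -1 < α - 1)).const_mul C
    rw [intervalIntegrable_iff, uIoc_of_le hT.le] at this
    exact this.mono_set Ioo_subset_Ioc_self
  exact Integrable.mono' h1 hw.aestronglyMeasurable hC

theorem norm_integral_indicator_le {w : ℝ → E} (hα : 0 < α) (hC0 : 0 ≤ C)
    (hC : ∀ᵐ t ∂(volume.restrict (Ioo 0 T)), ‖w t‖ ≤ C * t ^ (α - 1)) {s t : ℝ} (hs : 0 ≤ s)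
    (hst : s ≤ t) :
    ‖∫ r in s..t, (Ioo 0 T).indicator w r‖ ≤ C / α * (t ^ α - s ^ α) := by
  have h1 : ∫ r in s..t, C * r ^ (α - 1) = C / α * (t ^ α - s ^ α) := by
    rw [intervalIntegral.integral_const_mul, integral_rpow (Or.inl (by linarith)),
      sub_add_cancel]
    ring
  rw [← h1]
  refine intervalIntegral.norm_integral_le_of_norm_le hst ?_
    ((intervalIntegral.intervalIntegrable_rpow' (by linarith)).const_mul C)
  filter_upwards [(ae_restrict_iff' measurableSet_Ioo).1 hC] with r hr hrs
  by_cases h : r ∈ Ioo 0 T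
  · rw [indicator_of_mem h]
    exact hr h
  · rw [indicator_of_notMem h, norm_zero]
    have := hs.trans hrs.1.le
    positivity

theorem HasWeakDerivOn.exists_ae_eq_add_integral_indicator [CompleteSpace E] {v w : ℝ → E}
    (hT : 0 < T) (h : HasWeakDerivOn v w (Ioo 0 T))
    (hi : Integrable ((Ioo 0 T).indicator w)) :
    ∃ a : E, ∀ᵐ t, t ∈ Ioo 0 T → v t = a + ∫ r in (0 : ℝ)..t, (Ioo 0 T).indicator w r := by
  have hmid : T / 2 ∈ Ioo 0 T := ⟨by linarith, by linarith⟩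
  obtain ⟨a, ha⟩ := HasWeakDerivOn.exists_ae_eq_add_integral isOpen_Ioo ordConnected_Ioo h hmid
  refine ⟨a - ∫ r in (0 : ℝ)..(T / 2), (Ioo 0 T).indicator w r, ?_⟩
  filter_upwards [ha] with t ht hts
  rw [ht hts, ← intervalIntegral.integral_add_adjacent_intervals
    (hi.intervalIntegrable (a := 0) (b := T / 2)) (hi.intervalIntegrable (a := T / 2) (b := t))]
  have e : ∫ r in T / 2..t, w r = ∫ r in T / 2..t, (Ioo 0 T).indicator w r := by
    refine intervalIntegral.integral_congr fun r hr => ?_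
    rw [indicator_of_mem (ordConnected_Ioo.uIcc_subset hmid hts hr)]
  rw [e]
  abel

theorem HasWeakDerivOn.ae_norm_sub_le [CompleteSpace E] {w z : ℝ → E} (hα1 : α < 1) (hT : 0 < T)
    (hC0 : 0 ≤ C) (h : HasWeakDerivOn w z (Ioo 0 T))
    (hC : ∀ᵐ t ∂(volume.restrict (Ioo 0 T)), ‖z t‖ ≤ C * t ^ (α - 2)) :
    ∃ W : ℝ → E, (∀ᵐ t, t ∈ Ioo 0 T → w t = W t) ∧
      ∀ r r', 0 < r → r ≤ r' → r' < T → ‖W r - W r'‖ ≤ C * (r' - r) * r ^ (α - 2) := by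
  have hmid : T / 2 ∈ Ioo 0 T := ⟨by linarith, by linarith⟩
  obtain ⟨a, ha⟩ := HasWeakDerivOn.exists_ae_eq_add_integral isOpen_Ioo ordConnected_Ioo h hmid
  refine ⟨_, ha, fun r r' hr hrr hrT => ?_⟩
  have h1 : r ∈ Ioo 0 T := ⟨hr, hrr.trans_lt hrT⟩
  have h2 : r' ∈ Ioo 0 T := ⟨hr.trans_le hrr, hrT⟩
  rw [norm_sub_rev, add_sub_add_left_eq_sub, intervalIntegral.integral_interval_sub_left
    (LocallyIntegrableOn.intervalIntegrable ordConnected_Ioo h.2.1 hmid h2)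
    (LocallyIntegrableOn.intervalIntegrable ordConnected_Ioo h.2.1 hmid h1)]
  have h3 := intervalIntegral.norm_integral_le_of_norm_le_const_ae (a := r) (b := r') (f := z)
    (C := C * r ^ (α - 2)) (by
      filter_upwards [(ae_restrict_iff' measurableSet_Ioo).1 hC] with x hx hxr
      rw [uIoc_of_le hrr] at hxr
      refine (hx ⟨hr.trans hxr.1, hxr.2.trans_lt hrT⟩).trans (mul_le_mul_of_nonneg_left ?_ hC0)
      exact Real.rpow_le_rpow_of_nonpos hr hxr.1.le (by linarith))
  rw [abs_of_nonneg (by linarith)] at h3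
  linarith

/-- After a translation both increments are integrals over the same window, with integrand g(r) -
g(r+t-s). The Lipschitz bound for the representative `W` of the derivative applies pointwise, with
its constant taken at the left end s. -/
theorem norm_second_difference_le {w W : ℝ → E} (hα1 : α < 1) (hC0 : 0 ≤ C)
    (hi : Integrable ((Ioo 0 T).indicator w))
    (hwW : ∀ᵐ t, t ∈ Ioo 0 T → w t = W t)
    (hW : ∀ r r', 0 < r → r ≤ r' → r' < T → ‖W r - W r'‖ ≤ C * (r' - r) * r ^ (α - 2))
    {s t h : ℝ} (hs : 0 < s) (hst : s ≤ t) (hh : 0 ≤ h) (hT : t + h ≤ T) :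
    ‖(∫ r in s..(s + h), (Ioo 0 T).indicator w r) - ∫ r in t..(t + h), (Ioo 0 T).indicator w r‖ ≤
      C * (t - s) * s ^ (α - 2) * h := by
  set g := (Ioo 0 T).indicator w with hg
  have e1 : ∫ r in t..(t + h), g r = ∫ r in s..(s + h), g (r + (t - s)) := by
    rw [intervalIntegral.integral_comp_add_right]
    congr 1 <;> ring
  rw [e1, ← intervalIntegral.integral_sub hi.intervalIntegrable
    (hi.comp_add_right (t - s)).intervalIntegrable]
  have hne : ∀ᵐ r : ℝ, r ≠ s + h := by simp [ae_iff, measure_singleton]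
  have htr : ∀ᵐ r : ℝ, r + (t - s) ∈ Ioo 0 T → w (r + (t - s)) = W (r + (t - s)) :=
    (measurePreserving_add_right volume (t - s)).quasiMeasurePreserving.ae hwW
  have h3 := intervalIntegral.norm_integral_le_of_norm_le_const_ae (a := s) (b := s + h)
    (f := fun r => g r - g (r + (t - s))) (C := C * (t - s) * s ^ (α - 2)) (by
      filter_upwards [hwW, htr, hne] with r h1 h2 h3 hr
      rw [uIoc_of_le (by linarith)] at hr
      have hlt : r < s + h := lt_of_le_of_ne hr.2 h3
      have m1 : r ∈ Ioo 0 T := ⟨hs.trans hr.1, by linarith⟩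
      have m2 : r + (t - s) ∈ Ioo 0 T := ⟨by linarith [hr.1], by linarith⟩
      rw [hg, indicator_of_mem m1, indicator_of_mem m2, h1 m1, h2 m2]
      refine (hW _ _ m1.1 (by linarith) m2.2).trans ?_
      rw [add_sub_cancel_left]
      exact mul_le_mul_of_nonneg_left (Real.rpow_le_rpow_of_nonpos hs hr.1.le (by linarith))
        (mul_nonneg hC0 (by linarith)))
  rw [add_sub_cancel_left, abs_of_nonneg hh] at h3
  exact h3

/-- A function with two weak derivatives in time that grow like `t^(α-1)` and `t^(α-2)` has a
continuous representative with the corresponding modulus of continuity. -/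
theorem HasWeakDerivOn.exists_holder_representative [CompleteSpace E] {v w z : ℝ → E}
    (hα : 0 < α) (hα1 : α < 1) (hT : 0 < T) (hC0 : 0 ≤ C) (hvw : HasWeakDerivOn v w (Ioo 0 T))
    (hwz : HasWeakDerivOn w z (Ioo 0 T))
    (hw : ∀ᵐ t ∂(volume.restrict (Ioo 0 T)), ‖w t‖ ≤ C * t ^ (α - 1))
    (hz : ∀ᵐ t ∂(volume.restrict (Ioo 0 T)), ‖z t‖ ≤ C * t ^ (α - 2)) :
    ∃ V : ℝ → E, Continuous V ∧ (∀ᵐ t, t ∈ Ioo 0 T → v t = V t) ∧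
      (∀ s t, 0 ≤ s → s ≤ t → ‖V t - V s‖ ≤ C / α * (t ^ α - s ^ α)) ∧
      ∀ s t h, 0 < s → s ≤ t → 0 ≤ h → t + h ≤ T →
        ‖(V (s + h) - V s) - (V (t + h) - V t)‖ ≤ C * (t - s) * s ^ (α - 2) * h := by
  have hi := integrable_indicator_of_norm_le hα hT hvw.2.1 hw
  obtain ⟨a, ha⟩ := HasWeakDerivOn.exists_ae_eq_add_integral_indicator hT hvw hi
  obtain ⟨W, hW1, hW2⟩ := HasWeakDerivOn.ae_norm_sub_le hα1 hT hC0 hwz hz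
  have hdiff : ∀ s t : ℝ, (a + ∫ r in (0 : ℝ)..t, (Ioo 0 T).indicator w r) -
      (a + ∫ r in (0 : ℝ)..s, (Ioo 0 T).indicator w r) = ∫ r in s..t, (Ioo 0 T).indicator w r :=
    fun s t => by
      rw [add_sub_add_left_eq_sub, intervalIntegral.integral_interval_sub_left
        hi.intervalIntegrable hi.intervalIntegrable]
  refine ⟨fun t => a + ∫ r in (0 : ℝ)..t, (Ioo 0 T).indicator w r, ?_, ha, ?_, ?_⟩
  · exact continuous_const.add (intervalIntegral.continuous_primitive
      (fun _ _ => hi.intervalIntegrable) 0)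
  · intro s t hs hst
    simp only
    rw [hdiff]
    exact norm_integral_indicator_le hα hC0 hw hs hst
  · intro s t h hs hst hh hT'
    simp only
    rw [hdiff, hdiff]
    exact norm_second_difference_le hα1 hC0 hi hW1 hW2 hs hst hh hT'

/-- A set of full measure is dense, so what holds a.e. and is closed under limits holds at every
time, t = 0 included. -/
theorem Icc_subset_closure_of_ae {p : ℝ → Prop} (hT : 0 < T) (h : ∀ᵐ t, t ∈ Ioo 0 T → p t) :
    Icc 0 T ⊆ closure {t | t ∈ Ioo 0 T ∧ p t} := by
  have hd : Dense {t | t ∈ Ioo 0 T → p t} := Measure.dense_of_ae h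
  rw [← closure_Ioo hT.ne]
  refine closure_minimal ((hd.open_subset_closure_inter isOpen_Ioo).trans
    (closure_mono ?_)) isClosed_closure
  exact fun t ht => ⟨ht.1, ht.2 ht.1⟩

end TimeRegularity

/-! ### The equation integrated in time. -/

section IntegratedEquation

open Filter Topology

variable {α β T C : ℝ}

theorem rpow_sub_rpow_le_mul {r t a : ℝ} (hα1 : α < 1) (ha : 0 < a) (har : a ≤ r)
    (hrt : r ≤ t) : t ^ α - r ^ α ≤ a ^ (α - 1) * (t - r) := by
  have hr : 0 < r := ha.trans_le har
  have ht : 0 < t := hr.trans_le hrt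
  have h1 : t ^ (α - 1) ≤ r ^ (α - 1) := Real.rpow_le_rpow_of_nonpos hr hrt (by linarith)
  have h2 : r ^ (α - 1) ≤ a ^ (α - 1) := Real.rpow_le_rpow_of_nonpos ha har (by linarith)
  have e1 : t ^ α = t ^ (α - 1) * t := by rw [← Real.rpow_add_one ht.ne', sub_add_cancel]
  have e2 : r ^ α = r ^ (α - 1) * r := by rw [← Real.rpow_add_one hr.ne', sub_add_cancel]
  rw [e1, e2]
  nlinarith

theorem rpow_smul_ekIntegral {E : Type*} [NormedAddCommGroup E] [NormedSpace ℝ E] (hβ : 0 < β)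
    (φ : ℝ → E) {t : ℝ} (ht : 0 < t) :
    t ^ α • ekIntegral (α / β) 0 β φ t = kernelIntegral α β φ t := by
  have e : t ^ α * (α / β / Real.Gamma β * t ^ (-(α / β * (β + 0)))) = α / β / Real.Gamma β := by
    rw [add_zero, div_mul_cancel₀ _ hβ.ne', mul_left_comm, ← Real.rpow_add ht, add_neg_cancel,
      Real.rpow_zero, mul_one]
  rw [ekIntegral, smul_smul, e, kernelIntegral, ← intervalIntegral.integral_smul]
  refine intervalIntegral.integral_congr fun s _ => ?_
  simp only [kernel]
  rw [smul_smul, zero_add, mul_one]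

/-- The product rule for t^α · I produces α t^(α-1) I + t^α I', which is (α/β) t^(α-1) (β I + (β/α)
t I'). -/
theorem hasDerivAt_kernelIntegral {E : Type*} [NormedAddCommGroup E] [NormedSpace ℝ E]
    (hα : 0 < α) (hβ : 0 < β) {φ : ℝ → E} {t : ℝ} (ht : 0 < t)
    (hd : DifferentiableAt ℝ (fun r => ekIntegral (α / β) 0 β φ r) t) :
    HasDerivAt (kernelIntegral α β φ)
      ((α / β * t ^ (α - 1)) • ekDeriv (α / β) (β - 1) (1 - β) φ t) t := by
  have h1 := (Real.hasDerivAt_rpow_const (p := α) (Or.inl ht.ne')).smul hd.hasDerivAt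
  have h2 : (fun r => r ^ α • ekIntegral (α / β) 0 β φ r) =ᶠ[𝓝 t] kernelIntegral α β φ := by
    filter_upwards [lt_mem_nhds ht] with r hr
    exact rpow_smul_ekIntegral hβ φ hr
  refine (h1.congr_of_eventuallyEq h2.symm).congr_deriv ?_
  have e1 : β - 1 + (1 - β) = 0 := by ring
  have e2 : 1 - (1 - β) = β := by ring
  have e3 : t ^ α = t ^ (α - 1) * t := by rw [← Real.rpow_add_one ht.ne', sub_add_cancel]
  rw [ekDeriv, e1, e2, smul_add, smul_smul, smul_smul, add_comm]
  congr 2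
  · field_simp
    ring
  · rw [e3]
    field_simp

theorem kernelIntegral_congr_ae {E : Type*} [NormedAddCommGroup E] [NormedSpace ℝ E]
    {v V : ℝ → E} (h : ∀ᵐ t, t ∈ Ioo 0 T → v t = V t) {t : ℝ} (ht : t ∈ Ico 0 T) :
    kernelIntegral α β v t = kernelIntegral α β V t := by
  refine intervalIntegral.integral_congr_ae ?_
  filter_upwards [h] with s hs hst
  rw [uIoc_of_le ht.1] at hst
  rw [hs ⟨hst.1, hst.2.trans_lt ht.2⟩]

variable {u0 : L2} {u ut ux V : ℝ → L2}

/-- By closedness of the weak derivative. The case t = 0, not covered by the equation, identifies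
V(0) with the derivative of u_0. -/
theorem IsWeakSolution.hasSpaceDeriv_representative (hT : 0 < T)
    (hu : IsWeakSolution α β T u0 u ut ux) (hVc : Continuous V)
    (hV : ∀ᵐ t, t ∈ Ioo 0 T → ux t = V t) : ∀ t ∈ Icc 0 T, HasSpaceDeriv (u t) (V t) := by
  intro t ht
  set G := {t | t ∈ Ioo 0 T ∧ ux t = V t} with hG
  have : (𝓝[G] t).NeBot := mem_closure_iff_nhdsWithin_neBot.1 (Icc_subset_closure_of_ae hT hV ht)
  have hGI : G ⊆ Icc 0 T := fun x hx => Ioo_subset_Icc_self hx.1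
  refine HasSpaceDeriv.of_tendsto (l := 𝓝[G] t) (F := u) (G := V) ?_
    ((hu.continuousOn t ht).mono_left (nhdsWithin_mono _ hGI)) hVc.continuousAt.continuousWithinAt
  filter_upwards [self_mem_nhdsWithin] with r hr
  rw [← hr.2]
  exact hu.space_deriv r (Ioo_subset_Ioc_self hr.1)

theorem IsWeakSolution.inner_sub_eq_integral (hα : 0 < α) (hT : 0 < T)
    (hu : IsWeakSolution α β T u0 u ut ux)
    (hut : ∀ᵐ t ∂(volume.restrict (Ioo 0 T)), ‖ut t‖ ≤ C * t ^ (α - 1)) (χ : L2) {a b : ℝ}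
    (ha : a ∈ Ioo 0 T) (hb : b ∈ Ioo 0 T) :
    inner ℝ (u b) χ - inner ℝ (u a) χ = ∫ t in a..b, inner ℝ (ut t) χ := by
  have hi := integrable_indicator_of_norm_le hα hT hu.time_deriv.2.1 hut
  obtain ⟨c, hc⟩ := HasWeakDerivOn.exists_ae_eq_add_integral_indicator hT hu.time_deriv hi
  have heq : EqOn u (fun t => c + ∫ r in (0 : ℝ)..t, (Ioo 0 T).indicator ut r) (Icc 0 T) := by
    refine EqOn.of_subset_closure (fun t ht => ht.2) hu.continuousOn ?_
      (fun x hx => Ioo_subset_Icc_self hx.1) (Icc_subset_closure_of_ae hT hc)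
    exact (continuous_const.add (intervalIntegral.continuous_primitive
      (fun _ _ => hi.intervalIntegrable) 0)).continuousOn
  have hsub : u b - u a = ∫ t in a..b, ut t := by
    rw [heq (Ioo_subset_Icc_self ha), heq (Ioo_subset_Icc_self hb)]
    simp only
    rw [add_sub_add_left_eq_sub, intervalIntegral.integral_interval_sub_left
      hi.intervalIntegrable hi.intervalIntegrable]
    refine intervalIntegral.integral_congr fun r hr => ?_
    rw [indicator_of_mem (ordConnected_Ioo.uIcc_subset ha hb hr)]
  have hii : IntervalIntegrable ut volume a b :=
    LocallyIntegrableOn.intervalIntegrable ordConnected_Ioo hu.time_deriv.2.1 ha hb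
  rw [← inner_sub_left, hsub, real_inner_comm]
  have := (innerSL ℝ χ).intervalIntegral_comp_comm hii
  simp only [innerSL_apply_apply] at this
  rw [← this]
  exact intervalIntegral.integral_congr fun t _ => real_inner_comm _ _

/-- The Erdélyi–Kober diffusion equation integrated in time. -/
theorem IsWeakSolution.integrated_equation (hα : 0 < α) (hα1 : α < 1) (hβ : 0 < β) (hT : 0 < T)
    (hu : IsWeakSolution α β T u0 u ut ux) {A : ℝ} (hA : 0 ≤ A)
    (hut : ∀ᵐ t ∂(volume.restrict (Ioo 0 T)), ‖ut t‖ ≤ C * t ^ (α - 1)) (hVc : Continuous V)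
    (hV : ∀ᵐ t, t ∈ Ioo 0 T → ux t = V t)
    (hVh : ∀ s t, 0 ≤ s → s ≤ t → ‖V t - V s‖ ≤ A * (t ^ α - s ^ α)) {χ χx : L2}
    (hχ : HasSpaceDeriv χ χx) {t : ℝ} (ht : t ∈ Icc 0 T) :
    inner ℝ (u t) χ = inner ℝ u0 χ - inner ℝ (kernelIntegral α β V t) χx := by
  obtain ⟨M, hM⟩ : ∃ M, ∀ s, 0 ≤ s → s ≤ T → ‖V s‖ ≤ M := by
    obtain ⟨M, hM⟩ := isCompact_Icc.exists_bound_of_continuousOn (s := Icc 0 T) hVc.continuousOn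
    exact ⟨M, fun s h1 h2 => hM s ⟨h1, h2⟩⟩
  have hM0 : 0 ≤ M := (norm_nonneg _).trans (hM 0 le_rfl hT.le)
  have hκ := kappa_pos hβ
  set K := kappa β * (A * T ^ α + M) with hK
  have hK0 : 0 ≤ K := by positivity
  have hJ : ∀ r t, 0 ≤ r → r ≤ t → t ≤ T →
      ‖kernelIntegral α β V t - kernelIntegral α β V r‖ ≤ K * (t ^ α - r ^ α) := by
    intro r t hr hrt htT
    refine (norm_kernelIntegral_sub_le hα hβ hVc hA hVh hr hrt
      (fun s h1 h2 => hM s h1 (h2.trans htT))).trans ?_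
    refine mul_le_mul_of_nonneg_right ?_ (sub_nonneg.2 (Real.rpow_le_rpow hr hrt hα.le))
    exact mul_le_mul_of_nonneg_left (by
      have := Real.rpow_le_rpow (hr.trans hrt) htT hα.le
      nlinarith) hκ.le
  have hJc : ContinuousOn (kernelIntegral α β V) (Icc 0 T) := by
    intro x hx
    have hpow : Tendsto (fun t : ℝ => K * |t ^ α - x ^ α|) (𝓝[Icc 0 T] x) (𝓝 0) := by
      have h1 : Continuous fun t : ℝ => K * |t ^ α - x ^ α| :=
        continuous_const.mul ((Real.continuous_rpow_const hα.le).sub continuous_const).abs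
      have h2 := (h1.tendsto x).mono_left (nhdsWithin_le_nhds (s := Icc 0 T))
      simpa using h2
    rw [ContinuousWithinAt, tendsto_iff_norm_sub_tendsto_zero]
    refine squeeze_zero' (Eventually.of_forall fun _ => norm_nonneg _) ?_ hpow
    filter_upwards [self_mem_nhdsWithin] with t ht
    rcases le_total x t with h | h
    · rw [abs_of_nonneg (sub_nonneg.2 (Real.rpow_le_rpow hx.1 h hα.le))]
      exact hJ x t hx.1 h ht.2
    · rw [norm_sub_rev, abs_sub_comm, abs_of_nonneg (sub_nonneg.2 (Real.rpow_le_rpow ht.1 h hα.le))]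
      exact hJ t x ht.1 h hx.2
  set g : ℝ → ℝ := fun t => inner ℝ (kernelIntegral α β V t) χx with hg
  -- t^α is Lipschitz away from 0, so on such intervals `g` is recovered from its a.e. derivative.
  have hAC : ∀ a b, 0 < a → a ≤ b → b ≤ T → AbsolutelyContinuousOnInterval g a b := by
    intro a b ha hab hbT
    have hlip : ∀ r ∈ Icc a b, ∀ t ∈ Icc a b, r ≤ t →
        |g t - g r| ≤ K * a ^ (α - 1) * ‖χx‖ * (t - r) := by
      intro r hr t ht hrt
      rw [hg]
      simp only
      rw [← inner_sub_left]
      refine (abs_real_inner_le_norm _ _).trans ?_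
      have h1 := hJ r t (ha.le.trans hr.1) hrt (ht.2.trans hbT)
      have h2 := mul_le_mul_of_nonneg_left (rpow_sub_rpow_le_mul hα1 ha hr.1 hrt) hK0
      have h3 := mul_le_mul_of_nonneg_right (h1.trans h2) (norm_nonneg χx)
      linarith
    have hc0 : 0 ≤ K * a ^ (α - 1) * ‖χx‖ := by positivity
    refine LipschitzOnWith.absolutelyContinuousOnInterval
      (K := (K * a ^ (α - 1) * ‖χx‖).toNNReal) (LipschitzOnWith.of_dist_le_mul ?_)
    rw [uIcc_of_le hab]
    intro x hx y hy
    rw [Real.dist_eq, Real.dist_eq, Real.coe_toNNReal _ hc0]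
    rcases le_total x y with h | h
    · rw [abs_sub_comm, abs_sub_comm x y, abs_of_nonneg (sub_nonneg.2 h)]
      exact hlip x hx y hy h
    · rw [abs_of_nonneg (sub_nonneg.2 h)]
      exact hlip y hy x hx h
  have hderiv : ∀ᵐ t, t ∈ Ioo 0 T → deriv g t = -inner ℝ (ut t) χ := by
    filter_upwards [(ae_restrict_iff' measurableSet_Ioo).1 hu.equation] with t ht hts
    obtain ⟨hd, heq⟩ := ht hts
    have h1 := hasDerivAt_kernelIntegral hα hβ hts.1 hd
    have h2 : kernelIntegral α β V =ᶠ[𝓝 t] kernelIntegral α β ux := by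
      filter_upwards [isOpen_Ioo.mem_nhds hts] with r hr
      exact (kernelIntegral_congr_ae hV (Ioo_subset_Ico_self hr)).symm
    have h3 := (h1.congr_of_eventuallyEq h2).inner ℝ (hasDerivAt_const t χx)
    rw [h3.deriv, heq χ χx hχ, inner_zero_right, inner_smul_left]
    simp
  have hconst : ∀ a ∈ Ioo 0 T, ∀ b ∈ Ioo 0 T, a ≤ b →
      inner ℝ (u b) χ + g b = inner ℝ (u a) χ + g a := by
    intro a ha b hb hab
    have h1 := (hAC a b ha.1 hab hb.2.le).integral_deriv_eq_sub
    have h2 := hu.inner_sub_eq_integral hα hT hut χ ha hb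
    have h3 : ∫ t in a..b, deriv g t = ∫ t in a..b, -inner ℝ (ut t) χ := by
      refine intervalIntegral.integral_congr_ae ?_
      filter_upwards [hderiv] with t ht hts
      exact ht (ordConnected_Ioo.uIcc_subset ha hb (uIoc_subset_uIcc hts))
    rw [intervalIntegral.integral_neg] at h3
    linarith
  have hmid : T / 2 ∈ Ioo 0 T := ⟨by linarith, by linarith⟩
  -- The conserved quantity is continuous up to both ends, so its value may be read off at t = 0,
  -- where J vanishes.
  have hall : EqOn (fun t => inner ℝ (u t) χ + g t)
      (fun _ => inner ℝ (u (T / 2)) χ + g (T / 2)) (Icc 0 T) := by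
    refine EqOn.of_subset_closure (s := Ioo 0 T) (fun t ht => ?_) ?_ continuousOn_const
      Ioo_subset_Icc_self (closure_Ioo hT.ne).ge
    · rcases le_total t (T / 2) with h | h
      · exact (hconst t ht _ hmid h).symm
      · exact hconst _ hmid t ht h
    · exact (hu.continuousOn.inner continuousOn_const).add (hJc.inner continuousOn_const)
  have e1 := hall ht
  have e0 := hall (left_mem_Icc.2 hT.le)
  have g0 : g 0 = 0 := by simp [hg, kernelIntegral]
  simp only at e1 e0
  rw [g0, hu.initial] at e0
  linarith

end IntegratedEquation

end ErdelyiKober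

namespace ErdelyiKober

/-! ### The scheme on the unit grid and its energy estimate. -/

section SemiDiscrete

variable {α β T C k : ℝ}

theorem rpow_mul_ekCoeff (hα : 0 < α) (hβ : 0 < β) {n j : ℕ} (hj : j < n) :
    (n : ℝ) ^ α * ekCoeff α β n (j + 1) = weight α β n j := by
  have hη := (div_pos hα hβ).le
  have hj1 : (j : ℝ) + 1 ≤ n := by exact_mod_cast hj
  have hj0 : (0 : ℝ) ≤ j := Nat.cast_nonneg j
  have hn : (0 : ℝ) < n := by linarith
  have key : ∀ x : ℝ, 0 ≤ x → x ≤ n → (n : ℝ) ^ α * (1 - (x / n) ^ (α / β)) ^ β =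
      ((n : ℝ) ^ (α / β) - x ^ (α / β)) ^ β := by
    intro x hx hxn
    have h1 : (x / n) ^ (α / β) ≤ 1 :=
      Real.rpow_le_one (by positivity) ((div_le_one hn).2 hxn) hη
    rw [← rpow_div_rpow hβ hn.le, ← Real.mul_rpow (by positivity) (by linarith), mul_sub, mul_one,
      ← Real.mul_rpow hn.le (by positivity), mul_div_cancel₀ _ hn.ne']
  rw [ekCoeff, weight, kappa, ← key _ hj0 (by linarith), ← key _ (by linarith) hj1]
  push_cast
  rw [add_sub_cancel_right]
  ring

theorem weightedSum_eq_rpow_smul {E : Type*} [NormedAddCommGroup E] [NormedSpace ℝ E]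
    (hα : 0 < α) (hβ : 0 < β) (φ : ℕ → E) (n : ℕ) :
    weightedSum α β (fun j => φ (j + 1)) n = (n : ℝ) ^ α • discreteEkIntegral α β φ n := by
  rw [weightedSum, discreteEkIntegral, ← Finset.Ico_add_one_right_eq_Icc,
    Finset.sum_Ico_eq_sum_range, Nat.add_sub_cancel, Finset.smul_sum]
  refine Finset.sum_congr rfl fun j hj => ?_
  rw [add_comm 1 j, smul_smul, rpow_mul_ekCoeff hα hβ (Finset.mem_range.1 hj)]

/-- The discrete product rule. Multiplication by n^α turns `L` into `weightedSum`; the term β L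
becomes the extra α/(m+1), and reweighting L^m by (m+1)^α instead of m^α becomes ((m+1)/m)^α. -/
theorem smul_discreteEkDeriv {E : Type*} [NormedAddCommGroup E] [NormedSpace ℝ E]
    (hα : 0 < α) (hβ : 0 < β) (hk : 0 < k) (φ : ℕ → E) (m : ℕ) :
    (k * (α / β * (((m + 1 : ℕ) : ℝ) * k) ^ (α - 1))) • discreteEkDeriv α β k φ (m + 1) =
      k ^ α • discreteOp α β (fun j => φ (j + 1)) m := by
  have hm0 : (0 : ℝ) ≤ m := Nat.cast_nonneg m
  rw [discreteOp, weightedSum_eq_rpow_smul hα hβ, weightedSum_eq_rpow_smul hα hβ, discreteEkDeriv,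
    Nat.add_sub_cancel]
  set L := discreteEkIntegral α β φ with hL
  push_cast
  set x := (m : ℝ) + 1 with hx
  have hx0 : 0 < x := by positivity
  have e1 : x ^ α = x ^ (α - 1) * x := by rw [← Real.rpow_add_one hx0.ne', sub_add_cancel]
  have e2 : k ^ α = k ^ (α - 1) * k := by rw [← Real.rpow_add_one hk.ne', sub_add_cancel]
  have e3 : (x / m) ^ α • (m : ℝ) ^ α • L m = x ^ α • L m := by
    rcases Nat.eq_zero_or_pos m with h | h
    · have : L m = 0 := by simp [hL, h, discreteEkIntegral]
      simp [this]
    · rw [smul_smul, hx, div_rpow_mul_rpow (by exact_mod_cast h)]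
  rw [e3, Real.mul_rpow hx0.le hk.le, e1, e2]
  simp only [smul_add, smul_sub, smul_smul]
  have c1 : k * (α / β * (x ^ (α - 1) * k ^ (α - 1))) * β +
      k * (α / β * (x ^ (α - 1) * k ^ (α - 1))) * (β / α * (x * k) * (1 / k)) =
      k ^ (α - 1) * k * ((1 + α / x) * (x ^ (α - 1) * x)) := by
    field_simp
    ring
  have c2 : k * (α / β * (x ^ (α - 1) * k ^ (α - 1))) * (β / α * (x * k) * (1 / k)) =
      k ^ (α - 1) * k * (x ^ (α - 1) * x) := by
    field_simp
  rw [← c1, ← c2]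
  module

theorem sum_add_one_rpow_le (hα : 0 < α) (hα1 : α < 1) (N : ℕ) :
    ∑ m ∈ Finset.range N, ((m : ℝ) + 1) ^ (α - 1) ≤ (N : ℝ) ^ α / α := by
  induction N with
  | zero => simp [Real.zero_rpow hα.ne']
  | succ N ih =>
    rw [Finset.sum_range_succ]
    have hN : (0 : ℝ) ≤ N := Nat.cast_nonneg N
    have h : (N : ℝ) ^ α + α * ((N : ℝ) + 1) ^ (α - 1) ≤ ((N : ℝ) + 1) ^ α := by
      rw [Real.rpow_sub_one (by linarith)]
      rcases hN.eq_or_lt with h0 | h0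
      · rw [← h0, Real.zero_rpow hα.ne']
        simp [hα1.le]
      · have h := div_add_one_rpow_le hα hα1 h0
        rw [Real.div_rpow hN (by linarith),
          div_le_iff₀ (Real.rpow_pos_of_pos (by linarith) _)] at h
        have e : (1 - α / ((N : ℝ) + 1)) * ((N : ℝ) + 1) ^ α =
          ((N : ℝ) + 1) ^ α - α * (((N : ℝ) + 1) ^ α / ((N : ℝ) + 1)) := by ring
        linarith
    push_cast
    rw [le_div_iff₀ hα] at ih ⊢
    linarith

/-- The energy estimate for the error of the semi-discrete scheme. -/
theorem norm_le_of_error_inequality {H : Type*} [NormedAddCommGroup H] [InnerProductSpace ℝ H]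
    (hα : 0 < α) (hα1 : α < 1) (hβ : 0 < β) (hβ1 : β < 1) (hk : 0 < k) {a b : ℝ} (ha : 0 ≤ a)
    {e y : ℕ → H} {N : ℕ} (hN : (N : ℝ) * k ≤ T) (he0 : e 0 = 0)
    (h : ∀ m, m < N → inner ℝ (e (m + 1) - e m) (e (m + 1)) ≤
      k ^ α * (-inner ℝ (discreteOp α β y m) (y m) + a * |constDefect α m| * ‖e (m + 1)‖ +
        b * k ^ α * ((m : ℝ) + 1) ^ (α - 1) * ‖y m‖)) :
    ‖e N‖ ≤ 2 * Real.sqrt (4 * α ^ 2 * a ^ 2 + b ^ 2 * T ^ α / (2 * α ^ 2 * kappa β)) * k ^ α := by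
  have hκ := kappa_pos hβ
  set r := k ^ α with hr
  have hr0 : 0 < r := Real.rpow_pos_of_pos hk _
  -- Summing only up to the index of the largest error lets each ‖e_(m+1)‖ next to the defect be
  -- replaced by the maximum M.
  obtain ⟨n, hn, hmax⟩ := Finset.exists_max_image (Finset.range (N + 1)) (fun i => ‖e i‖)
    ⟨0, by simp⟩
  set M := ‖e n‖ with hM
  have hM0 : 0 ≤ M := norm_nonneg _
  have hnN : n ≤ N := Nat.lt_succ_iff.1 (Finset.mem_range.1 hn)
  set Q := b ^ 2 * T ^ α / (2 * α ^ 2 * kappa β) with hQ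
  have hT0 : 0 ≤ T := le_trans (by positivity) hN
  have hQ0 : 0 ≤ Q := by positivity
  have hstep : ∀ m ∈ Finset.range n, 1 / 2 * (‖e (m + 1)‖ ^ 2 - ‖e m‖ ^ 2) ≤
      r * (1 / 2 * (α * kappa β * ((m : ℝ) + 1) ^ (α - 1)) * ‖y m‖ ^ 2 -
        inner ℝ (discreteOp α β y m) (y m)) + r * a * M * |constDefect α m| +
        r * (b ^ 2 * r ^ 2 / (2 * α * kappa β)) * ((m : ℝ) + 1) ^ (α - 1) := by
    intro m hm
    have hm := Finset.mem_range.1 hm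
    have h1 := h m (hm.trans_le hnN)
    have h2 : 1 / 2 * (‖e (m + 1)‖ ^ 2 - ‖e m‖ ^ 2) ≤ inner ℝ (e (m + 1) - e m) (e (m + 1)) := by
      have := real_inner_le_norm (e m) (e (m + 1))
      rw [inner_sub_left, real_inner_self_eq_norm_sq]
      nlinarith [sq_nonneg (‖e (m + 1)‖ - ‖e m‖)]
    have h3 : ‖e (m + 1)‖ ≤ M := hmax _ (Finset.mem_range.2 (by omega))
    set X := ((m : ℝ) + 1) ^ (α - 1) with hX
    have hX0 : 0 < X := Real.rpow_pos_of_pos (by positivity) _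
    -- Young's inequality with the first term chosen to be exactly the coercive one.
    have h4 : b * r * X * ‖y m‖ ≤ 1 / 2 * (α * kappa β * X) * ‖y m‖ ^ 2 +
        b ^ 2 * r ^ 2 / (2 * α * kappa β) * X := by
      have hc : 0 < α * kappa β := by positivity
      have h5 : b * r * ‖y m‖ ≤ 1 / 2 * (α * kappa β) * ‖y m‖ ^ 2 +
          b ^ 2 * r ^ 2 / (2 * α * kappa β) := by
        have e5 : 1 / 2 * (α * kappa β) * ‖y m‖ ^ 2 + b ^ 2 * r ^ 2 / (2 * α * kappa β) -
            b * r * ‖y m‖ = (α * kappa β * ‖y m‖ - b * r) ^ 2 / (2 * (α * kappa β)) := by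
          field_simp
          ring
        have : 0 ≤ (α * kappa β * ‖y m‖ - b * r) ^ 2 / (2 * (α * kappa β)) := by positivity
        linarith
      have := mul_le_mul_of_nonneg_right h5 hX0.le
      linarith
    have h6 : a * |constDefect α m| * ‖e (m + 1)‖ ≤ a * |constDefect α m| * M :=
      mul_le_mul_of_nonneg_left h3 (by positivity)
    refine (h2.trans h1).trans ?_
    have h7 := mul_le_mul_of_nonneg_left (add_le_add h6 h4) hr0.le
    linarith
  have hsum := Finset.sum_le_sum hstep
  rw [← Finset.mul_sum, Finset.sum_range_sub (fun i => ‖e i‖ ^ 2), he0, norm_zero,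
    Finset.sum_add_distrib, Finset.sum_add_distrib, ← Finset.mul_sum, ← Finset.mul_sum,
    ← Finset.mul_sum, Finset.sum_sub_distrib] at hsum
  have hco := sum_inner_discreteOp_ge hα hα1 hβ hβ1 y n
  have hde := sum_abs_constDefect_le hα hα1 n
  have hpw := sum_add_one_rpow_le hα hα1 n
  have hnT : r * (n : ℝ) ^ α ≤ T ^ α := by
    rw [hr, ← Real.mul_rpow hk.le (Nat.cast_nonneg n)]
    refine Real.rpow_le_rpow (by positivity) (le_trans ?_ hN) hα.le
    rw [mul_comm]
    exact mul_le_mul_of_nonneg_right (by exact_mod_cast hnN) hk.le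
  have b1 : r * (∑ m ∈ Finset.range n, 1 / 2 * (α * kappa β * ((m : ℝ) + 1) ^ (α - 1)) * ‖y m‖ ^ 2 -
      ∑ m ∈ Finset.range n, inner ℝ (discreteOp α β y m) (y m)) ≤ 0 :=
    mul_nonpos_of_nonneg_of_nonpos hr0.le (by linarith)
  have b2 : r * a * M * ∑ m ∈ Finset.range n, |constDefect α m| ≤ r * a * M * (2 * α) :=
    mul_le_mul_of_nonneg_left hde (by positivity)
  have b3 : r * (b ^ 2 * r ^ 2 / (2 * α * kappa β)) *
      ∑ m ∈ Finset.range n, ((m : ℝ) + 1) ^ (α - 1) ≤ r ^ 2 * Q := by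
    have h1 : r * (b ^ 2 * r ^ 2 / (2 * α * kappa β)) *
        ∑ m ∈ Finset.range n, ((m : ℝ) + 1) ^ (α - 1) ≤
        r * (b ^ 2 * r ^ 2 / (2 * α * kappa β)) * ((n : ℝ) ^ α / α) :=
      mul_le_mul_of_nonneg_left hpw (by positivity)
    have h2 : r * (b ^ 2 * r ^ 2 / (2 * α * kappa β)) * ((n : ℝ) ^ α / α) =
        b ^ 2 * r ^ 2 / (2 * α ^ 2 * kappa β) * (r * (n : ℝ) ^ α) := by field_simp
    have h3 : b ^ 2 * r ^ 2 / (2 * α ^ 2 * kappa β) * (r * (n : ℝ) ^ α) ≤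
        b ^ 2 * r ^ 2 / (2 * α ^ 2 * kappa β) * T ^ α :=
      mul_le_mul_of_nonneg_left hnT (by positivity)
    have h4 : b ^ 2 * r ^ 2 / (2 * α ^ 2 * kappa β) * T ^ α = r ^ 2 * Q := by rw [hQ]; ring
    linarith
  -- The sum gives M²/2 ≤ 2αarM + r²Q; half of the left side absorbs the linear term.
  have hfin : M ^ 2 ≤ (2 * Real.sqrt (4 * α ^ 2 * a ^ 2 + Q) * r) ^ 2 := by
    rw [mul_pow, mul_pow, Real.sq_sqrt (by positivity)]
    have : r * a * M * (2 * α) ≤ 1 / 4 * M ^ 2 + 4 * α ^ 2 * a ^ 2 * r ^ 2 := by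
      nlinarith [sq_nonneg (M / 2 - 2 * α * a * r)]
    linarith
  refine (hmax N (by simp)).trans ?_
  exact abs_le_of_sq_le_sq' hfin (by positivity) |>.2

theorem IsSemiDiscreteSolution.step {u0 : L2} {U Ux : ℕ → L2} (hα : 0 < α) (hβ : 0 < β)
    (hk : 0 < k) (hU : IsSemiDiscreteSolution α β T k u0 U Ux) {m : ℕ}
    (hm : ((m + 1 : ℕ) : ℝ) * k ≤ T) {χ χx : L2} (hχ : HasSpaceDeriv χ χx) :
    inner ℝ (U (m + 1) - U m) χ =
      -(k ^ α * inner ℝ (discreteOp α β (fun j => Ux (j + 1)) m) χx) := by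
  have h := hU.equation (m + 1) (by omega) hm χ χx hχ
  rw [Nat.add_sub_cancel, real_inner_smul_left] at h
  have h2 := congrArg (fun v => inner ℝ v χx) (smul_discreteEkDeriv hα hβ hk Ux m)
  simp only [real_inner_smul_left] at h2
  rw [← h2]
  have h3 : inner ℝ (U (m + 1) - U m) χ = k * (1 / k * inner ℝ (U (m + 1) - U m) χ) := by
    field_simp
  rw [h3, h]
  ring

/-- The consistency error of the scheme for the representative `V` of `u_x`. -/
theorem norm_consistency_le {E : Type*} [NormedAddCommGroup E] [NormedSpace ℝ E] [CompleteSpace E]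
    (hα : 0 < α) (hα1 : α < 1) (hβ : 0 < β) (hβ1 : β < 1) (hk : 0 < k) (hC0 : 0 ≤ C) {V : ℝ → E}
    (hVc : Continuous V)
    (hVh : ∀ s t, 0 ≤ s → s ≤ t → ‖V t - V s‖ ≤ C / α * (t ^ α - s ^ α))
    (hV2 : ∀ s t h, 0 < s → s ≤ t → 0 ≤ h → t + h ≤ T →
      ‖(V (s + h) - V s) - (V (t + h) - V t)‖ ≤ C * (t - s) * s ^ (α - 2) * h) {m : ℕ}
    (hm : ((m + 1 : ℕ) : ℝ) * k ≤ T) :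
    ‖kernelIntegral α β (fun s => V (k * s)) (m + 1) - kernelIntegral α β (fun s => V (k * s)) m -
      discreteOp α β (fun j : ℕ => V (k * (j + 1))) m - (kappa β * constDefect α m) • V 0‖ ≤
      consistencyConst α β * (4 * C / α * k ^ α) * ((m : ℝ) + 1) ^ (α - 1) := by
  have hkα : 0 < k ^ α := Real.rpow_pos_of_pos hk _
  have hCα : 0 ≤ C / α * k ^ α := by positivity
  have hHol : ∀ s t, 0 ≤ s → s ≤ t → ‖V (k * t) - V (k * s)‖ ≤ C / α * k ^ α * (t ^ α - s ^ α) := by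
    intro s t hs hst
    refine (hVh _ _ (by positivity) (mul_le_mul_of_nonneg_left hst hk.le)).trans (le_of_eq ?_)
    rw [Real.mul_rpow hk.le (hs.trans hst), Real.mul_rpow hk.le hs]
    ring
  have h := norm_kernelIntegral_sub_sub_discreteOp_le hα hα1 hβ hβ1 (f := fun s => V (k * s))
    (hVc.comp (continuous_const.mul continuous_id)) (A := 4 * C / α * k ^ α) (by positivity)
    (fun s t hs hst => (hHol s t hs hst).trans (mul_le_mul_of_nonneg_right (by
      have : 4 * C / α * k ^ α = 4 * (C / α * k ^ α) := by ring
      linarith) (sub_nonneg.2 (Real.rpow_le_rpow hs hst hα.le)))) m (by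
    intro j hj s hs
    have hj0 : (0 : ℝ) ≤ j := Nat.cast_nonneg j
    -- On the first cell s^(α-2) is unbounded, so the second difference is estimated by two first
    -- differences, each at most (C/α) k^α.
    rcases Nat.eq_zero_or_pos j with h0 | h0
    · subst h0
      simp only [Nat.cast_zero, zero_add] at hs ⊢
      rw [Real.one_rpow, mul_one, mul_one]
      have h1 := hHol s (s + 1) hs.1.le (by linarith)
      have h2 := hHol 1 2 zero_le_one (by norm_num)
      rw [mul_one k] at h2
      have h3 := rpow_sub_rpow_sub_one_le hα hα1.le hs.1.le
      have h4 := rpow_sub_rpow_sub_one_le hα hα1.le zero_le_one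
      have h5 : (s + 1) ^ (α - 1) ≤ 1 :=
        Real.rpow_le_one_of_one_le_of_nonpos (by linarith [hs.1]) (by linarith)
      have h6 : ((1 : ℝ) + 1) ^ (α - 1) ≤ 1 :=
        Real.rpow_le_one_of_one_le_of_nonpos (by linarith) (by linarith)
      rw [one_add_one_eq_two] at h4 h6
      have h7 := mul_le_mul_of_nonneg_left (h3.trans h5) hCα
      have h8 := mul_le_mul_of_nonneg_left (h4.trans h6) hCα
      have e : 4 * C / α * k ^ α = 4 * (C / α * k ^ α) := by ring
      refine (norm_sub_le _ _).trans ?_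
      linarith
    · have hj1 : (1 : ℝ) ≤ j := by exact_mod_cast h0
      have hjm : (j : ℝ) + 1 ≤ m := by exact_mod_cast hj
      have hs0 : 0 < s := by linarith [hs.1]
      push_cast at hm
      have h1 := hV2 (k * s) (k * (j + 1)) k (by positivity)
        (mul_le_mul_of_nonneg_left hs.2.le hk.le) hk.le (by nlinarith)
      have e1 : k * s + k = k * (s + 1) := by ring
      have e2 : k * ((j : ℝ) + 1) + k = k * (j + 2) := by ring
      rw [e1, e2] at h1
      refine h1.trans ?_
      rw [Real.mul_rpow hk.le hs0.le]
      have e3 : k ^ α = k ^ (α - 2) * k * k := by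
        rw [← Real.rpow_add_one hk.ne', ← Real.rpow_add_one hk.ne']
        congr 1
        ring
      -- For j ≥ 1, s > j ≥ (j+1)/2, and 2^(2-α) ≤ 4; hence the 4 in the consistency constant.
      have h2 : s ^ (α - 2) ≤ 4 * ((j : ℝ) + 1) ^ (α - 2) := by
        have h3 : s ^ (α - 2) ≤ (((j : ℝ) + 1) / 2) ^ (α - 2) :=
          Real.rpow_le_rpow_of_nonpos (by positivity) (by linarith [hs.1]) (by linarith)
        rw [Real.div_rpow (by positivity) zero_le_two] at h3
        refine h3.trans ?_
        rw [div_le_iff₀ (by positivity)]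
        have h4 : (1 : ℝ) ≤ 4 * 2 ^ (α - 2) := by
          have : (2 : ℝ) ^ (-2 : ℝ) ≤ 2 ^ (α - 2) :=
            Real.rpow_le_rpow_of_exponent_le one_le_two (by linarith)
          have e4 : (2 : ℝ) ^ (-2 : ℝ) = 1 / 4 := by
            rw [Real.rpow_neg zero_le_two]; norm_num
          rw [e4] at this
          linarith
        have h5 : 0 ≤ ((j : ℝ) + 1) ^ (α - 2) := by positivity
        nlinarith
      have h6 : C ≤ C / α := by rw [le_div_iff₀ hα]; nlinarith
      have h7 : (j : ℝ) + 1 - s ≤ 1 := by linarith [hs.1]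
      have h8 : 0 ≤ (j : ℝ) + 1 - s := by linarith [hs.2]
      calc C * (k * (j + 1) - k * s) * (k ^ (α - 2) * s ^ (α - 2)) * k
          = C * ((j : ℝ) + 1 - s) * s ^ (α - 2) * k ^ α := by rw [e3]; ring
        _ ≤ C / α * 1 * (4 * ((j : ℝ) + 1) ^ (α - 2)) * k ^ α := by gcongr
        _ = 4 * C / α * k ^ α * ((j : ℝ) + 1) ^ (α - 2) := by ring)
  simpa using h

end SemiDiscrete

end ErdelyiKober

namespace ErdelyiKober

/-! ### Convergence of order k^α. -/

section Convergence

variable {α β T C : ℝ}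

theorem norm_le_mul_rpow_of_rpow_mul_norm_le {F : Type*} [NormedAddCommGroup F] {w : ℝ → F}
    {p : ℝ} (h : ∀ᵐ t ∂(volume.restrict (Ioo 0 T)), t ^ p * ‖w t‖ ≤ C) :
    ∀ᵐ t ∂(volume.restrict (Ioo 0 T)), ‖w t‖ ≤ C * t ^ (-p) := by
  filter_upwards [h, ae_restrict_mem measurableSet_Ioo] with t ht hts
  rw [Real.rpow_neg hts.1.le, ← div_eq_mul_inv, le_div_iff₀ (Real.rpow_pos_of_pos hts.1 _),
    mul_comm]
  exact ht

/-- Convergence of order `k ^ α` of the semi-discrete scheme. -/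
theorem exists_norm_error_le (hα : 0 < α) (hα1 : α < 1) (hβ : 0 < β) (hβ1 : β < 1) (hT : 0 < T)
    (hC0 : 0 ≤ C) {u0 : L2} (hu0 : MemH2 u0) {u ut ux V : ℝ → L2}
    (hu : IsWeakSolution α β T u0 u ut ux)
    (hut : ∀ᵐ t ∂(volume.restrict (Ioo 0 T)), ‖ut t‖ ≤ C * t ^ (α - 1))
    (hVc : Continuous V) (hV : ∀ᵐ t, t ∈ Ioo 0 T → ux t = V t)
    (hVh : ∀ s t, 0 ≤ s → s ≤ t → ‖V t - V s‖ ≤ C / α * (t ^ α - s ^ α))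
    (hV2 : ∀ s t h, 0 < s → s ≤ t → 0 ≤ h → t + h ≤ T →
      ‖(V (s + h) - V s) - (V (t + h) - V t)‖ ≤ C * (t - s) * s ^ (α - 2) * h) :
    ∃ D : ℝ, 0 ≤ D ∧ ∀ k : ℝ, 0 < k → ∀ U Ux : ℕ → L2,
      IsSemiDiscreteSolution α β T k u0 U Ux → ∀ n : ℕ, (n : ℝ) * k ≤ T →
        ‖U n - u ((n : ℝ) * k)‖ ≤ D * k ^ α := by
  have hκ := kappa_pos hβ
  have hrep := hu.hasSpaceDeriv_representative hT hVc hV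
  obtain ⟨g, h, hg, hh⟩ := hu0
  have hV0 : V 0 = g := by
    have := hrep 0 (left_mem_Icc.2 hT.le)
    rw [hu.initial] at this
    exact this.unique hg
  set a := kappa β * ‖h‖ with ha
  set b := consistencyConst α β * (4 * C / α) with hb
  refine ⟨2 * Real.sqrt (4 * α ^ 2 * a ^ 2 + b ^ 2 * T ^ α / (2 * α ^ 2 * kappa β)),
    by positivity, fun k hk U Ux hU N hN => ?_⟩
  have hkα : 0 < k ^ α := Real.rpow_pos_of_pos hk _
  refine norm_le_of_error_inequality (T := T) (e := fun n => U n - u ((n : ℝ) * k))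
    (y := fun m => Ux (m + 1) - V (k * (m + 1))) hα hα1 hβ hβ1 hk (by positivity) hN ?_ ?_
  · simp [hU.initial, hu.initial]
  intro m hmN
  have hm0 : (0 : ℝ) ≤ m := Nat.cast_nonneg m
  have hm1 : ((m + 1 : ℕ) : ℝ) * k ≤ T :=
    le_trans (mul_le_mul_of_nonneg_right (by exact_mod_cast hmN) hk.le) hN
  have hmT : (m : ℝ) * k ≤ T := le_trans (mul_le_mul_of_nonneg_right (by push_cast; linarith) hk.le) hm1
  have hI1 : ((m + 1 : ℕ) : ℝ) * k ∈ Icc 0 T := ⟨by positivity, hm1⟩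
  have hI0 : (m : ℝ) * k ∈ Icc 0 T := ⟨by positivity, hmT⟩
  have c1 : ((m + 1 : ℕ) : ℝ) * k = k * ((m : ℝ) + 1) := by push_cast; ring
  have c0 : (m : ℝ) * k = k * m := mul_comm _ _
  -- The error itself is the test function; its space derivative is the argument y of the coercive
  -- form.
  set χ := U (m + 1) - u (((m + 1 : ℕ) : ℝ) * k) with hχdef
  set χx := Ux (m + 1) - V (k * (m + 1)) with hχxdef
  have hχ : HasSpaceDeriv χ χx := by
    refine (hU.space_deriv (m + 1) (by omega) hm1).sub ?_
    rw [← c1]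
    exact hrep _ hI1
  have e1 := hU.step hα hβ hk hm1 hχ
  have hCα : 0 ≤ C / α := by positivity
  have e2 := hu.integrated_equation hα hα1 hβ hT hCα hut hVc hV hVh hχ hI1
  have e3 := hu.integrated_equation hα hα1 hβ hT hCα hut hVc hV hVh hχ hI0
  rw [c1, kernelIntegral_mul hα hβ V hk (by positivity), real_inner_smul_left] at e2
  rw [c0, kernelIntegral_mul hα hβ V hk hm0, real_inner_smul_left] at e3
  have hcons := norm_consistency_le hα hα1 hβ hβ1 hk hC0 hVc hVh hV2 hm1
  set J1 := kernelIntegral α β (fun s => V (k * s)) (m + 1)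
  set J0 := kernelIntegral α β (fun s => V (k * s)) m
  set dV := discreteOp α β (fun j : ℕ => V (k * (j + 1))) m with hdV
  set R := J1 - J0 - dV - (kappa β * constDefect α m) • V 0 with hR
  have hop : discreteOp α β (fun j => Ux (j + 1)) m =
      discreteOp α β (fun j => Ux (j + 1) - V (k * (j + 1))) m + dV := by
    rw [discreteOp_sub (fun j => Ux (j + 1)) (fun j : ℕ => V (k * (j + 1))) m, hdV,
      sub_add_cancel]
  set dy := discreteOp α β (fun j => Ux (j + 1) - V (k * (j + 1))) m with hdy
  have hR' : inner ℝ J1 χx - inner ℝ J0 χx =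
      inner ℝ R χx + inner ℝ dV χx + kappa β * constDefect α m * inner ℝ (V 0) χx := by
    rw [hR, inner_sub_left, inner_sub_left, inner_sub_left, real_inner_smul_left]
    ring
  have hmain : inner ℝ (U (m + 1) - u (((m + 1 : ℕ) : ℝ) * k) - (U m - u ((m : ℝ) * k))) χ =
      k ^ α * (-inner ℝ dy χx - kappa β * constDefect α m * inner ℝ h χ + inner ℝ R χx) := by
    -- Here u_0 ∈ H² enters: the defect term is paired with χ, where only the summed defect and the
    -- maximal error matter.
    have hIBP : inner ℝ (V 0) χx = -inner ℝ h χ := by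
      rw [hV0]
      exact hh.inner_deriv_right hχ
    have e4 : U (m + 1) - u (((m + 1 : ℕ) : ℝ) * k) - (U m - u ((m : ℝ) * k)) =
        (U (m + 1) - U m) - (u (k * ((m : ℝ) + 1)) - u (k * m)) := by
      rw [c1, c0]; abel
    rw [e4, inner_sub_left, inner_sub_left (u _), e1, e2, e3, hop, inner_add_left]
    rw [hIBP] at hR'
    linear_combination k ^ α * hR'
  have hh1 : -(kappa β * constDefect α m * inner ℝ h χ) ≤ a * |constDefect α m| * ‖χ‖ := by
    refine (neg_le_abs _).trans ?_
    rw [abs_mul, abs_mul, abs_of_pos hκ, ha]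
    have := mul_le_mul_of_nonneg_left (abs_real_inner_le_norm h χ)
      (mul_nonneg hκ.le (abs_nonneg (constDefect α m)))
    linarith
  have hh2 : inner ℝ R χx ≤ b * k ^ α * ((m : ℝ) + 1) ^ (α - 1) * ‖χx‖ := by
    refine (real_inner_le_norm _ _).trans (mul_le_mul_of_nonneg_right (hcons.trans_eq ?_)
      (norm_nonneg _))
    rw [hb]
    ring
  rw [hmain]
  refine mul_le_mul_of_nonneg_left ?_ hkα.le
  linarith

end Convergence

end ErdelyiKober

/-! ### The stated rates from the order k^α. -/

theorem mainTheorem4 (α β T C : ℝ) (hα0 : 0 < α) (hα1 : α < 1) (hβ0 : 0 < β) (hβ1 : β < 1)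
    (hT : 0 < T) (u0 : ErdelyiKober.L2) (hu0 : ErdelyiKober.MemH2 u0)
    (u ut utt ux utx uttx : ℝ → ErdelyiKober.L2)
    (hu : ErdelyiKober.IsWeakSolution α β T u0 u ut ux)
    (hutt : ErdelyiKober.HasWeakDerivOn ut utt (Set.Ioo 0 T))
    (hutx : ErdelyiKober.HasWeakDerivOn ux utx (Set.Ioo 0 T))
    (huttx : ErdelyiKober.HasWeakDerivOn utx uttx (Set.Ioo 0 T))
    (hbound : ∀ᵐ t ∂(MeasureTheory.volume.restrict (Set.Ioo 0 T)),
      ‖u t‖ + t ^ (1 - α) * ‖ut t‖ + t ^ (2 - α) * ‖utt t‖ ≤ C)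
    (hboundx : ∀ᵐ t ∂(MeasureTheory.volume.restrict (Set.Ioo 0 T)),
      ‖ux t‖ + t ^ (1 - α) * ‖utx t‖ + t ^ (2 - α) * ‖uttx t‖ ≤ C)
    (μ : ℝ) (hμ : 0 < μ) :
    ∃ D : ℝ, 0 < D ∧ ∀ k : ℝ, 0 < k → ∀ U Ux : ℕ → ErdelyiKober.L2,
      ErdelyiKober.IsSemiDiscreteSolution α β T k u0 U Ux →
      ∀ n : ℕ, (n : ℝ) * k ≤ T →
        (α ≠ β → ‖U n - u ((n : ℝ) * k)‖ ≤ D * k ^ (α - μ / 2)) ∧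
        (α = β → k < 1 → ‖U n - u ((n : ℝ) * k)‖ ≤
          D * (k ^ α * ((-Real.log k) ^ (1 / 2 : ℝ) + k ^ (μ / 2)))) := by
  have hpos : ∀ᵐ t ∂(volume.restrict (Ioo 0 T)), 0 < t := by
    filter_upwards [ae_restrict_mem measurableSet_Ioo] with t ht using ht.1
  have hC0 : 0 ≤ C := by
    have : (ae (volume.restrict (Ioo 0 T))).NeBot := by
      rw [ae_neBot, Ne, Measure.restrict_eq_zero, Real.volume_Ioo]
      simpa using hT
    obtain ⟨t, h1, h2⟩ := (hbound.and hpos).exists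
    exact le_trans (by positivity) h1
  have hut := ErdelyiKober.norm_le_mul_rpow_of_rpow_mul_norm_le (w := ut) (p := 1 - α) (C := C) (T := T) (by
    filter_upwards [hbound, hpos] with t ht h0
    have h1 : 0 ≤ t ^ (2 - α) * ‖utt t‖ := by positivity
    linarith [norm_nonneg (u t)])
  have hutx' := ErdelyiKober.norm_le_mul_rpow_of_rpow_mul_norm_le (w := utx) (p := 1 - α) (C := C) (T := T) (by
    filter_upwards [hboundx, hpos] with t ht h0
    have h1 : 0 ≤ t ^ (2 - α) * ‖uttx t‖ := by positivity
    linarith [norm_nonneg (ux t)])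
  have huttx' := ErdelyiKober.norm_le_mul_rpow_of_rpow_mul_norm_le (w := uttx) (p := 2 - α) (C := C) (T := T) (by
    filter_upwards [hboundx, hpos] with t ht h0
    have h1 : 0 ≤ t ^ (1 - α) * ‖utx t‖ := by positivity
    linarith [norm_nonneg (ux t)])
  rw [neg_sub] at hut hutx' huttx'
  obtain ⟨V, hVc, hV, hVh, hV2⟩ := ErdelyiKober.HasWeakDerivOn.exists_holder_representative
    hα0 hα1 hT hC0 hutx huttx hutx' huttx'
  obtain ⟨D, hD0, hD⟩ := ErdelyiKober.exists_norm_error_le hα0 hα1 hβ0 hβ1 hT hC0 hu0 hu hut hVc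
    hV hVh hV2
  -- A lower bound for the bracket when k < 1: for k ≤ 1/2 the logarithmic term is at least 1/2, and
  -- for k ≥ 1/2 the power is at least (1/2)^(μ/2).
  set c := (1 / 2 : ℝ) * (1 / 2) ^ (μ / 2) with hc
  have hc0 : 0 < c := by positivity
  -- The two summands serve α ≠ β and α = β respectively; the 1 ensures positivity.
  refine ⟨D * (T ^ (μ / 2) + c⁻¹) + 1, by positivity, fun k hk U Ux hU n hn => ?_⟩
  have herr := hD k hk U Ux hU n hn
  have hkα : 0 < k ^ α := Real.rpow_pos_of_pos hk _
  have hTμ : 0 < T ^ (μ / 2) := Real.rpow_pos_of_pos hT _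
  have hci : 0 < c⁻¹ := inv_pos.2 hc0
  -- For n = 0 the condition t_n ≤ T does not bound k, but the error is zero.
  rcases Nat.eq_zero_or_pos n with rfl | hn0
  · have hz : ‖U 0 - u (((0 : ℕ) : ℝ) * k)‖ = 0 := by simp [hU.initial, hu.initial]
    rw [hz]
    refine ⟨fun _ => by positivity, fun _ hk1 => ?_⟩
    have : 0 ≤ -Real.log k := neg_nonneg.2 (Real.log_nonpos hk.le hk1.le)
    positivity
  have hkT : k ≤ T := by
    have h1 : (1 : ℝ) ≤ n := by exact_mod_cast hn0
    nlinarith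
  constructor
  · intro _
    have h1 : k ^ α = k ^ (α - μ / 2) * k ^ (μ / 2) := by
      rw [← Real.rpow_add hk, sub_add_cancel]
    have h2 : k ^ (μ / 2) ≤ T ^ (μ / 2) := Real.rpow_le_rpow hk.le hkT (by positivity)
    have h3 : 0 < k ^ (α - μ / 2) := Real.rpow_pos_of_pos hk _
    calc ‖U n - u ((n : ℝ) * k)‖ ≤ D * k ^ α := herr
      _ = D * k ^ (μ / 2) * k ^ (α - μ / 2) := by rw [h1]; ring
      _ ≤ (D * (T ^ (μ / 2) + c⁻¹) + 1) * k ^ (α - μ / 2) := by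
        refine mul_le_mul_of_nonneg_right ?_ h3.le
        have := mul_le_mul_of_nonneg_left h2 hD0
        have := mul_nonneg hD0 hci.le
        linarith
  · intro _ hk1
    have hlog : 0 ≤ -Real.log k := neg_nonneg.2 (Real.log_nonpos hk.le hk1.le)
    set X := (-Real.log k) ^ (1 / 2 : ℝ) + k ^ (μ / 2) with hX
    have hhalf : (1 / 2 : ℝ) ^ (μ / 2) ≤ 1 :=
      Real.rpow_le_one (by norm_num) (by norm_num) (by positivity)
    have hhalf0 : 0 < (1 / 2 : ℝ) ^ (μ / 2) := by positivity
    have hXc : c ≤ X := by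
      rcases le_total k (1 / 2) with h | h
      · have h1 : 1 / 2 ≤ -Real.log k := by
          have h2 := Real.log_le_log hk h
          have h3 : Real.log (1 / 2) = -Real.log 2 := by rw [one_div, Real.log_inv]
          linarith [Real.log_two_gt_d9]
        have h2 : (1 / 2 : ℝ) ≤ (-Real.log k) ^ (1 / 2 : ℝ) := by
          refine le_trans ?_ (Real.rpow_le_rpow (by norm_num) h1 (by norm_num))
          have := Real.rpow_le_rpow_of_exponent_ge (x := 1 / 2) (by norm_num) (by norm_num)
            (by norm_num : (1 / 2 : ℝ) ≤ 1)
          rwa [Real.rpow_one] at this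
        have h3 : 0 ≤ k ^ (μ / 2) := by positivity
        have h4 : c ≤ 1 / 2 := mul_le_of_le_one_right (by norm_num) hhalf
        linarith
      · have h1 : (1 / 2 : ℝ) ^ (μ / 2) ≤ k ^ (μ / 2) :=
          Real.rpow_le_rpow (by norm_num) h (by positivity)
        have h2 : 0 ≤ (-Real.log k) ^ (1 / 2 : ℝ) := Real.rpow_nonneg hlog _
        linarith
    have h1 : 1 ≤ c⁻¹ * X := by rw [inv_mul_eq_div, le_div_iff₀ hc0]; linarith
    have hX0 : 0 ≤ X := hc0.le.trans hXc
    calc ‖U n - u ((n : ℝ) * k)‖ ≤ D * k ^ α := herr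
      _ ≤ D * k ^ α * (c⁻¹ * X) := le_mul_of_one_le_right (by positivity) h1
      _ = D * c⁻¹ * (k ^ α * X) := by ring
      _ ≤ (D * (T ^ (μ / 2) + c⁻¹) + 1) * (k ^ α * X) := by
        refine mul_le_mul_of_nonneg_right ?_ (by positivity)
        have := mul_nonneg hD0 hTμ.le
        linarith
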